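/- **Setting.** Let $d\ge 3$ and let $\mathbb Z^d$ carry its nearest-neighbour graph structure. For finite $K\subset\mathbb Z^d$ the capacity is $\mathrm{cap}(K)=\sum_{x\in K}2d\,P_x[X_n\notin K\ \forall n\ge 1]$, where $X$ is simple random walk. For $S\subset \mathbb Z^d$, $\overline S$ is the union of $S$ and all vertices having a neighbour in $S$. Let $\varphi=(\varphi_x)_{x\in\mathbb Z^d}$ be any real-valued field on $\mathbb Z^d$ defined on a sample space $\Omega$ (for instance the Gaussian free field), let $h\in\mathbb R$, and let $\mathcal C_o(h)$ be the connected component of the origin $o$ in $\{x:\varphi_x\ge h\}$ (empty if $\varphi_o<h$). For an integer $N\geq 1$ put $$A_N(h)=\{|\mathcal C_o(h)|<\infty\}\cap\{N-1\le \mathrm{cap}(\overline{\mathcal C_o(h)})<N\}.$$ For an integer $L\ge1$, the boxes of $L\mathbb Z^d$ are the sets $B_L(z)=z+[0,L)^d\cap\mathbb Z^d$, $z\in L\mathbb Z^d$; two of them are neighbours if their corners $z$ are neighbours in $L\mathbb Z^d\cong\mathbb Z^d$. Let $\mathcal C_o(h,L)$ be the set of boxes of $L\mathbb Z^d$ that contain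 a vertex of $\mathcal C_o(h)$, and $\partial\mathcal C_o(h,L)$ the set of those that have a neighbour not in $\mathcal C_o(h,L)$. The diameter $\mathrm{diam}$ is taken in the $\ell^\infty$-distance. A family of events $\mathcal E^b_B,\mathcal E^{vb}_B\subset\Omega$, indexed by the boxes $B$ of $L\mathbb Z^d$, is *$h$-admissible* if, with $\mathcal E_B=\mathcal E^b_B\cup\mathcal E^{vb}_B$: (i) $\mathcal E^b_B\cap\mathcal E^{vb}_B=\emptyset$ for every $B$; (ii) if $L\le\mathrm{diam}(\mathcal C_o(h))<\infty$, then $\mathcal E_B$ happens for every $B\in\partial\mathcal C_o(h,L)$; (iii) if $B,B'\in\mathcal C_o(h,L)$ are neighbours and $\mathcal E^b_B$ happens, then $\mathcal E_{B'}$ happens. An *interface* $\mathcal I$ is a nonempty finite collection of pairwise disjoint boxes, whose scales we denote by $1\le L_1<\dots<L_k$. It *occurs* if $\mathcal E_B$ happens for every $B\in\mathcal I$. Let $\mathcal B$ (resp. $\mathcal{VB}$) be the set of $B\in\mathcal I$ for which $\mathcal E^b_B$ (resp. $\mathcal E^{vb}_B$) happens. **Theorem.** For every $d\ge3$, $\rho>0$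 and $\delta>0$ there are constants $0<t<1$, $L_0>0$, $N_0>0$, depending only on $d,\rho,\delta$, such that for every $\varphi$ and $h$ as above, every family of events $\mathcal E^b_B,\mathcal E^{vb}_B$ that is $h$-admissible for each integer $L\ge1$, and every integer $N\ge N_0$, there is a (deterministic) finite family $\mathscr I_N$ of interfaces such that: (a) $|\mathscr I_N|\le e^{\delta tN}$; (b) for every $\mathcal I\in\mathscr I_N$, $L_0\le L_1$ and $|\mathcal I|\le\delta tN$; (c) on the event $A_N(h)$, some $\mathcal I\in\mathscr I_N$ occurs with $L_k\le\mathrm{diam}(\mathcal C_o(h))$ and $\mathcal B\subset L_1\mathbb Z^d$ (every box of $\mathcal B$ has scale $L_1$), and at least one of the following holds: (c1) $\mathrm{cap}\big(\bigcup_{B\in\mathcal{VB}}B\big)\ge \frac{N}{4d}$; (c2) $|\mathcal B|\,L_1^{\rho}\ge tN$. -/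

import Mathlib

open MeasureTheory ProbabilityTheory

namespace CoarseGraining

/-! ### Graph notions -/

/-- The hypercubic lattice `ℤ^d` with nearest-neighbour adjacency `‖x - y‖₁ = 1`. -/
def lattice (d : ℕ) : SimpleGraph (Fin d → ℤ) where
  Adj x y := ∑ i, |x i - y i| = 1
  symm := ⟨fun x y h => by simpa only [abs_sub_comm] using h⟩
  loopless := ⟨fun x h => by simp at h⟩

/-- The inner vertex boundary of `S`: the vertices of `S` with a neighbour outside `S`. -/
def innerBoundary {V : Type*} (G : SimpleGraph V) (S : Set V) : Set V :=
  {x | x ∈ S ∧ ∃ y, y ∉ S ∧ G.Adj x y}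

/-- The outer vertex boundary of `S`: the vertices outside `S` with a neighbour in `S`. -/
def outerBoundary {V : Type*} (G : SimpleGraph V) (S : Set V) : Set V :=
  {x | x ∉ S ∧ ∃ y, y ∈ S ∧ G.Adj x y}

/-- The vertex closure of `S`. -/
def vertexClosure {V : Type*} (G : SimpleGraph V) (S : Set V) : Set V :=
  S ∪ outerBoundary G S

/-! ### Simple random walk and capacity -/

/-- The unit step `e_i` (for `(i, true)`) or `-e_i` (for `(i, false)`). -/
def unitStep {d : ℕ} (s : Fin d × Bool) : Fin d → ℤ :=
  Pi.single s.1 (if s.2 then 1 else -1)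

/-- The law of a sequence of independent steps, uniform among the `2d` unit steps. -/
noncomputable def stepsLaw (d : ℕ) : Measure (ℕ → Fin d × Bool) :=
  Measure.infinitePi (fun _ : ℕ => uniformOn (Set.univ : Set (Fin d × Bool)))

/-- The position at time `n` of the walk started at `x` with step sequence `s`. -/
def walk {d : ℕ} (x : Fin d → ℤ) (s : ℕ → Fin d × Bool) (n : ℕ) : Fin d → ℤ :=
  x + ∑ k ∈ Finset.range n, unitStep (s k)

/-- The probability that simple random walk started at `x` is never in `K` at times `n ≥ 1`. -/
noncomputable def escapeProb {d : ℕ} (K : Set (Fin d → ℤ)) (x : Fin d → ℤ) : ℝ :=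
  (stepsLaw d).real {s | ∀ n : ℕ, 1 ≤ n → walk x s n ∉ K}

/-- The equilibrium measure of `K`; every vertex of `ℤ^d` has degree `2d`. -/
noncomputable def equilibriumMeasure {d : ℕ} (K : Set (Fin d → ℤ)) (x : Fin d → ℤ) : ℝ :=
  K.indicator (fun y => 2 * (d : ℝ) * escapeProb K y) x

/-- The capacity of `K`, the total mass of its equilibrium measure. It is used for finite `K` only,
so that the sum has finite support. -/
noncomputable def capacity {d : ℕ} (K : Set (Fin d → ℤ)) : ℝ :=
  ∑' x, equilibriumMeasure K x

/-! ### Clusters of level sets -/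

/-- The cluster of the origin in `{f ≥ h}`, i.e. its connected component in the subgraph of `ℤ^d`
induced by `{f ≥ h}`; it is empty if `f 0 < h`. -/
def cluster {d : ℕ} (f : (Fin d → ℤ) → ℝ) (h : ℝ) : Set (Fin d → ℤ) :=
  {x | ∃ (h0 : (0 : Fin d → ℤ) ∈ {y | h ≤ f y}) (hx : x ∈ {y | h ≤ f y}),
    ((lattice d).induce {y | h ≤ f y}).Reachable ⟨0, h0⟩ ⟨x, hx⟩}

/-- The event that the cluster of the origin is finite and that the capacity of its closure lies
in `[N - 1, N)`. -/
def capacityEvent {d : ℕ} {Ω : Type*} (φ : Ω → (Fin d → ℤ) → ℝ) (h : ℝ) (N : ℕ) : Set Ω :=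
  {ω | (cluster (φ ω) h).Finite ∧
    (N : ℝ) - 1 ≤ capacity (vertexClosure (lattice d) (cluster (φ ω) h)) ∧
    capacity (vertexClosure (lattice d) (cluster (φ ω) h)) < N}

/-! ### Boxes, admissible events, interfaces -/

/-- A box of `Lℤ^d`, where `L ≥ 1` is its scale. The renormalized lattice `Lℤ^d` is identified with
`ℤ^d`: the box with index `z` has corner `L z`. -/
@[ext]
structure Box (d : ℕ) where
  scale : ℕ+
  index : Fin d → ℤ

/-- The set of vertices `L z + [0, L)^d` of a box. -/
def Box.verts {d : ℕ} (B : Box d) : Set (Fin d → ℤ) :=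
  {x | ∀ i, (B.scale : ℤ) * B.index i ≤ x i ∧
    x i < (B.scale : ℤ) * B.index i + (B.scale : ℤ)}

/-- The (indices of the) boxes of `Lℤ^d` that contain a vertex of `C`. -/
def coarse {d : ℕ} (C : Set (Fin d → ℤ)) (L : ℕ+) : Set (Fin d → ℤ) :=
  {z | ((Box.mk L z).verts ∩ C).Nonempty}

/-- Admissibility at scale `L` of the families of bad events `Eb` and very-bad events `Evb`, for the
level set `{φ ≥ h}`. Here `Metric.diam` is the diameter for the supremum norm. -/
structure IsAdmissible {d : ℕ} {Ω : Type*} (φ : Ω → (Fin d → ℤ) → ℝ) (h : ℝ) (L : ℕ+)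
    (Eb Evb : Box d → Set Ω) : Prop where
  disjoint : ∀ z, Disjoint (Eb ⟨L, z⟩) (Evb ⟨L, z⟩)
  initiation : ∀ ω, (cluster (φ ω) h).Finite →
    ((L : ℕ) : ℝ) ≤ Metric.diam (cluster (φ ω) h) →
    ∀ z ∈ innerBoundary (lattice d) (coarse (cluster (φ ω) h) L), ω ∈ Eb ⟨L, z⟩ ∪ Evb ⟨L, z⟩
  propagation : ∀ ω, ∀ z ∈ coarse (cluster (φ ω) h) L, ∀ z' ∈ coarse (cluster (φ ω) h) L,
    (lattice d).Adj z z' → ω ∈ Eb ⟨L, z⟩ → ω ∈ Eb ⟨L, z'⟩ ∪ Evb ⟨L, z'⟩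

/-- An interface: a nonempty finite collection of pairwise disjoint boxes, possibly of several
scales. -/
structure Interface (d : ℕ) where
  boxes : Finset (Box d)
  nonempty : boxes.Nonempty
  pairwise_disjoint : ∀ B ∈ boxes, ∀ B' ∈ boxes, B ≠ B' → Disjoint B.verts B'.verts

namespace Interface

variable {d : ℕ} {Ω : Type*}

/-- The smallest scale of an interface. -/
def minScale (I : Interface d) : ℕ+ := I.boxes.inf' I.nonempty Box.scale

/-- The largest scale of an interface. -/
def maxScale (I : Interface d) : ℕ+ := I.boxes.sup' I.nonempty Box.scale

/-- The interface occurs if each of its boxes is bad or very bad. -/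
def Occurs (I : Interface d) (Eb Evb : Box d → Set Ω) (ω : Ω) : Prop :=
  ∀ B ∈ I.boxes, ω ∈ Eb B ∪ Evb B

open Classical in
/-- The boxes `B` of the interface for which the event `E B` happens. With `E` the bad events this
is the set of bad boxes, with `E` the very-bad events the set of very-bad boxes. -/
noncomputable def boxesWith (I : Interface d) (E : Box d → Set Ω) (ω : Ω) : Finset (Box d) :=
  I.boxes.filter (fun B => ω ∈ E B)

end Interface

end CoarseGraining

/-! The interface is found by a multiscale exploration of the cluster `C` of the origin, along the
dyadic scales from about `diam C` down to a fixed scale `l`. Among the boxes meeting `C`, a bad box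
is subdivided, while a very bad box is kept and not explored further. At scale `L` the number of
explored bad boxes is compared with `t N L ^ (-ρ)`. If some generation exceeds this threshold, the
bad boxes of the first such generation form an interface of a single scale, and (c2) holds.

Otherwise the very bad boxes of all generations form the interface, and (c1) has to be shown. A path
from `C` to infinity leaves the boxes meeting `C` through a boundary box, which is bad or very bad.
If the path avoids the very bad boxes, reading it backwards in time and using propagation shows that
all its boxes meeting `C` are bad. This repeats inside these boxes at the next scale, down to scale
`l` (`boxIndex_mem_badSet_of_path`). Hence the kept very bad boxes and the last bad boxes together
block every such path. By reversibility of the walk, a blocking set has capacity at least `1 / (2d)`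
times that of the closure of `C` (`capacity_le_mul_capacity`). There are at most `t N` last bad
boxes, each of volume `l ^ d`, so for small `t` they contribute little, and the very bad boxes carry
capacity `N / (4d)` (`capacity_vertexClosure_le`).

The entropy is small because each generation is chosen among the children of few bad boxes. The
thresholds sum over dyadic scales to a geometric series, at most a small multiple of `δ t N` once
`l` is large (`exists_finset_of_isExploration`, `exists_scale`). The number of generations must also
be guessed. It is at most polynomial in `N`, because the cardinality of a set is at most polynomial
in its capacity (`exists_card_le_of_capacity_lt`). This and the blocking argument use transience,
obtained from an explicit superharmonic function (`sum_superharm_le`). -/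

namespace CoarseGraining

open scoped ENNReal

/-! ### The Markov property of simple random walk -/

/-- Prepend a term to a sequence. -/
def seqCons {X : Type*} (e : X) (s : ℕ → X) : ℕ → X
  | 0 => e
  | n + 1 => s n

lemma measurable_seqCons {X : Type*} [MeasurableSpace X] :
    Measurable (fun p : X × (ℕ → X) => seqCons p.1 p.2) := by
  refine measurable_pi_iff.2 fun n => ?_
  cases n with
  | zero => exact measurable_fst
  | succ n => exact (measurable_pi_apply n).comp measurable_snd

/-- Both measures agree on finite cylinders. This is the source of the Markov property: it allows
conditioning on the first step. -/
lemma map_seqCons_prod_infinitePi {X : Type*} [MeasurableSpace X] (μ : Measure X)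
    [IsProbabilityMeasure μ] :
    (μ.prod (Measure.infinitePi fun _ : ℕ => μ)).map (fun p => seqCons p.1 p.2) =
      Measure.infinitePi (fun _ : ℕ => μ) := by
  classical
  refine Measure.eq_infinitePi _ fun s t ht => ?_
  rw [Measure.map_apply measurable_seqCons (.pi s.countable_toSet fun i _ => ht i)]
  have hpre : (fun p : X × (ℕ → X) => seqCons p.1 p.2) ⁻¹' (Set.pi s t) =
      (if 0 ∈ s then t 0 else Set.univ) ×ˢ
        Set.pi (s.preimage Nat.succ Nat.succ_injective.injOn : Finset ℕ) (fun n => t (n + 1)) := by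
    ext ⟨e, u⟩
    simp only [Set.mem_preimage, Set.mem_pi, Set.mem_prod, Finset.coe_preimage, Finset.mem_coe]
    constructor
    · intro h
      refine ⟨?_, fun i hi => h (i + 1) hi⟩
      split_ifs with h0
      · exact h 0 h0
      · trivial
    · rintro ⟨h0, h1⟩ i hi
      cases i with
      | zero => rw [if_pos hi] at h0; exact h0
      | succ i => exact h1 i hi
  rw [hpre, Measure.prod_prod, Measure.infinitePi_pi _ (fun i _ => ht (i + 1))]
  by_cases h0 : 0 ∈ s
  · rw [if_pos h0, ← Finset.mul_prod_erase s (fun i => μ (t i)) h0]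
    congr 1
    rw [show s.erase 0 = (s.preimage Nat.succ Nat.succ_injective.injOn).image Nat.succ by
      ext i; cases i <;> simp, Finset.prod_image Nat.succ_injective.injOn]
  · rw [if_neg h0, measure_univ, one_mul]
    conv_rhs => rw [show s = (s.preimage Nat.succ Nat.succ_injective.injOn).image Nat.succ by
      ext i; cases i <;> simp [h0]]
    rw [Finset.prod_image Nat.succ_injective.injOn]

section RandomWalk

set_option linter.unusedSectionVars false

variable {d : ℕ} [NeZero d]

instance : IsProbabilityMeasure (uniformOn (Set.univ : Set (Fin d × Bool))) :=
  isProbabilityMeasure_uniformOn Set.finite_univ ⟨(0, true), trivial⟩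

instance : IsProbabilityMeasure (stepsLaw d) := by
  unfold stepsLaw; infer_instance

lemma stepsLaw_eq_sum {E : Set (ℕ → Fin d × Bool)} (hE : MeasurableSet E) :
    stepsLaw d E = (2 * d : ℝ≥0∞)⁻¹ * ∑ e, stepsLaw d {s | seqCons e s ∈ E} := by
  have h := map_seqCons_prod_infinitePi (uniformOn (Set.univ : Set (Fin d × Bool)))
  have h1 : stepsLaw d E = ∫⁻ e, stepsLaw d {s | seqCons e s ∈ E}
      ∂(uniformOn (Set.univ : Set (Fin d × Bool))) := by
    unfold stepsLaw
    conv_lhs => rw [← h]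
    rw [Measure.map_apply measurable_seqCons hE,
      Measure.prod_apply (measurable_seqCons hE)]
    rfl
  rw [h1, lintegral_fintype, Finset.mul_sum]
  refine Finset.sum_congr rfl fun e _ => ?_
  rw [uniformOn_univ, mul_comm]
  congr 1
  simp [div_eq_mul_inv, mul_comm]

lemma walk_zero (x : Fin d → ℤ) (s : ℕ → Fin d × Bool) : walk x s 0 = x := by simp [walk]

lemma walk_seqCons (x : Fin d → ℤ) (e : Fin d × Bool) (s : ℕ → Fin d × Bool) (n : ℕ) :
    walk x (seqCons e s) (n + 1) = walk (x + unitStep e) s n := by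
  simp only [walk, Finset.sum_range_succ', seqCons]
  abel

lemma walk_add (x : Fin d → ℤ) (s : ℕ → Fin d × Bool) (n m : ℕ) :
    walk x s (n + m) = walk (walk x s n) (fun k => s (k + n)) m := by
  simp only [walk, Finset.sum_range_add, add_assoc]
  simp only [add_right_inj]
  exact Finset.sum_congr rfl fun k _ => by rw [Nat.add_comm]

lemma measurable_walk (x : Fin d → ℤ) (n : ℕ) :
    Measurable (fun s : ℕ → Fin d × Bool => walk x s n) := by
  unfold walk
  refine measurable_const.add (Finset.measurable_sum _ fun k _ => ?_)
  exact (measurable_of_countable unitStep).comp (measurable_pi_apply k)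

lemma measurableSet_walk_mem (x : Fin d → ℤ) (n : ℕ) (K : Set (Fin d → ℤ)) :
    MeasurableSet {s : ℕ → Fin d × Bool | walk x s n ∈ K} :=
  measurable_walk x n K.to_countable.measurableSet

/-- The transition probability of simple random walk in `n` steps. -/
noncomputable def transProb (n : ℕ) (x y : Fin d → ℤ) : ℝ≥0∞ :=
  stepsLaw d {s | walk x s n = y}

lemma transProb_zero (x y : Fin d → ℤ) : transProb 0 x y = if x = y then 1 else 0 := by
  unfold transProb
  split_ifs with h <;> simp [walk_zero, h]

lemma transProb_succ (n : ℕ) (x y : Fin d → ℤ) :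
    transProb (n + 1) x y = (2 * d : ℝ≥0∞)⁻¹ * ∑ e, transProb n (x + unitStep e) y := by
  unfold transProb
  rw [stepsLaw_eq_sum (E := {s | walk x s (n + 1) = y}) (measurableSet_walk_mem x (n + 1) {y})]
  simp [walk_seqCons]

lemma measurable_shift (n : ℕ) :
    Measurable (fun (s : ℕ → Fin d × Bool) (k : ℕ) => s (k + n)) :=
  measurable_pi_iff.2 fun k => measurable_pi_apply (k + n)

/-- The Markov property at time `n`, by induction through the first step. -/
lemma stepsLaw_walk_eq_and_shift_mem (n : ℕ) (x y : Fin d → ℤ) {A : Set (ℕ → Fin d × Bool)}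
    (hA : MeasurableSet A) :
    stepsLaw d {s | walk x s n = y ∧ (fun k => s (k + n)) ∈ A} =
      transProb n x y * stepsLaw d A := by
  induction n generalizing x with
  | zero =>
    rw [transProb_zero]
    split_ifs with h
    · simp only [walk_zero, h, true_and, one_mul]
      rfl
    · simp [walk_zero, h]
  | succ n ih =>
    rw [stepsLaw_eq_sum
      (E := {s | walk x s (n + 1) = y ∧ (fun k => s (k + (n + 1))) ∈ A}) (((measurableSet_walk_mem x (n + 1) {y})).inter
      (measurable_shift (n + 1) hA)), transProb_succ, mul_assoc, Finset.sum_mul]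
    congr 1
    refine Finset.sum_congr rfl fun e _ => ?_
    rw [← ih (x + unitStep e)]
    congr 1
    ext s
    simp only [Set.mem_ofPred_eq, walk_seqCons]
    rfl

lemma unitStep_not (e : Fin d × Bool) : unitStep (e.1, !e.2) = -unitStep e := by
  obtain ⟨i, b⟩ := e
  cases b <;> simp [unitStep, ← Pi.single_neg]

lemma sum_unitStep_neg {M : Type*} [AddCommMonoid M] (f : (Fin d → ℤ) → M) :
    ∑ e, f (-unitStep e) = ∑ e, f (unitStep e) := by
  simp_rw [← unitStep_not]
  exact Equiv.sum_comp (Equiv.prodCongr (Equiv.refl (Fin d)) Equiv.boolNot)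
    (fun e => f (unitStep e))

lemma transProb_add_right (n : ℕ) (x y z : Fin d → ℤ) :
    transProb n (x + z) (y + z) = transProb n x y := by
  unfold transProb
  congr 1
  ext s
  simp only [walk, Set.mem_ofPred_eq]
  rw [add_right_comm, add_left_inj]

lemma transProb_neg (n : ℕ) (x y : Fin d → ℤ) : transProb n (-x) (-y) = transProb n x y := by
  induction n generalizing x with
  | zero => simp [transProb_zero]
  | succ n ih =>
    rw [transProb_succ, transProb_succ,
      ← sum_unitStep_neg (fun v => transProb n (x + v) y)]
    congr 1
    refine Finset.sum_congr rfl fun e _ => ?_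
    rw [← ih (x + -unitStep e), neg_add, neg_neg]

/-- Reversibility: the reflection through the midpoint of `x` and `y` exchanges them and preserves
the law of the walk. -/
lemma transProb_comm (n : ℕ) (x y : Fin d → ℤ) : transProb n x y = transProb n y x := by
  rw [← transProb_neg, ← transProb_add_right n (-x) (-y) (x + y)]
  simp

/-! ### Green function and last exit decomposition -/

/-- The Green function of simple random walk. -/
noncomputable def green (x y : Fin d → ℤ) : ℝ≥0∞ := ∑' n, transProb n x y

lemma green_comm (x y : Fin d → ℤ) : green x y = green y x :=
  tsum_congr fun n => transProb_comm n x y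

/-- The escape probability, as an extended nonnegative real number. -/
noncomputable def escape (K : Set (Fin d → ℤ)) (x : Fin d → ℤ) : ℝ≥0∞ :=
  stepsLaw d {s | ∀ n : ℕ, 1 ≤ n → walk x s n ∉ K}

/-- The probability that the walk started at `x` visits `K`. -/
noncomputable def hitProb (K : Set (Fin d → ℤ)) (x : Fin d → ℤ) : ℝ≥0∞ :=
  stepsLaw d {s | ∃ n : ℕ, walk x s n ∈ K}

lemma hitProb_le_one (K : Set (Fin d → ℤ)) (x : Fin d → ℤ) : hitProb K x ≤ 1 := prob_le_one

lemma escape_anti {K K' : Set (Fin d → ℤ)} (h : K ⊆ K') (x : Fin d → ℤ) :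
    escape K' x ≤ escape K x :=
  measure_mono fun _ hs n hn hK => hs n hn (h hK)

lemma measurableSet_escape (K : Set (Fin d → ℤ)) (x : Fin d → ℤ) :
    MeasurableSet {s : ℕ → Fin d × Bool | ∀ n : ℕ, 1 ≤ n → walk x s n ∉ K} := by
  simp only [Set.ofPred_forall]
  exact .iInter fun n => .iInter fun _ => (measurableSet_walk_mem x n K).compl

lemma stepsLaw_walk_mem (K : Finset (Fin d → ℤ)) (x : Fin d → ℤ) (n : ℕ) :
    stepsLaw d {s | walk x s n ∈ K} = ∑ y ∈ K, transProb n x y := by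
  have : {s : ℕ → Fin d × Bool | walk x s n ∈ K} = ⋃ y ∈ K, {s | walk x s n = y} := by
    ext s; simp
  rw [this, measure_biUnion_finset]
  · rfl
  · intro y _ y' _ hne
    exact Set.disjoint_left.2 fun s h h' => hne (h.symm.trans h')
  · exact fun y _ => measurableSet_walk_mem x n {y}

lemma ae_eventually_walk_notMem (K : Finset (Fin d → ℤ)) (x : Fin d → ℤ)
    (hG : ∀ y, green x y ≠ ∞) :
    ∀ᵐ s ∂stepsLaw d, ∀ᶠ n in Filter.atTop, walk x s n ∉ K := by
  refine ae_eventually_notMem (s := fun n => {s | walk x s n ∈ K}) ?_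
  simp_rw [stepsLaw_walk_mem]
  rw [Summable.tsum_finsetSum (fun _ _ => ENNReal.summable)]
  exact (ENNReal.sum_lt_top.2 fun y _ => (hG y).lt_top).ne

/-- Decomposition over the time and place of the last visit to `K`. A finite Green function makes
the visits finite in number by Borel–Cantelli, so a walk that hits `K` almost surely has a last
visit. -/
lemma hitProb_eq_sum (K : Finset (Fin d → ℤ)) (x : Fin d → ℤ) (hG : ∀ y, green x y ≠ ∞) :
    hitProb (K : Set (Fin d → ℤ)) x = ∑ y ∈ K, green x y * escape (K : Set (Fin d → ℤ)) y := by
  classical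
  set E : ℕ → Set (ℕ → Fin d × Bool) :=
    fun n => {s | walk x s n ∈ K ∧ ∀ m : ℕ, 1 ≤ m → walk x s (n + m) ∉ K} with hE
  have hEeq : ∀ n, E n = ⋃ y ∈ K, {s | walk x s n = y ∧ (fun k => s (k + n)) ∈
      {s : ℕ → Fin d × Bool | ∀ m : ℕ, 1 ≤ m → walk y s m ∉ (K : Set (Fin d → ℤ))}} := by
    intro n
    ext s
    simp only [hE, walk_add, Set.mem_ofPred_eq, Set.mem_iUnion, Finset.mem_coe]
    constructor
    · rintro ⟨h, h'⟩
      exact ⟨_, h, rfl, h'⟩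
    · rintro ⟨y, hy, rfl, h'⟩
      exact ⟨hy, h'⟩
  have hmeas : ∀ n y, MeasurableSet {s : ℕ → Fin d × Bool | walk x s n = y ∧ (fun k => s (k + n)) ∈
      {s : ℕ → Fin d × Bool | ∀ m : ℕ, 1 ≤ m → walk y s m ∉ (K : Set (Fin d → ℤ))}} :=
    fun n y => (measurableSet_walk_mem x n {y}).inter
      (measurable_shift n (measurableSet_escape _ y))
  have hEm : ∀ n, MeasurableSet (E n) := fun n => by
    rw [hEeq]
    exact Finset.measurableSet_biUnion _ fun y _ => hmeas n y
  have hν : ∀ n, stepsLaw d (E n) =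
      ∑ y ∈ K, transProb n x y * escape (K : Set (Fin d → ℤ)) y := by
    intro n
    rw [hEeq, measure_biUnion_finset]
    · exact Finset.sum_congr rfl fun y _ =>
        stepsLaw_walk_eq_and_shift_mem n x y (measurableSet_escape _ y)
    · intro y _ y' _ hne
      exact Set.disjoint_left.2 fun s h h' => hne (h.1.symm.trans h'.1)
    · exact fun y _ => hmeas n y
  have hdisj : Pairwise (Function.onFun Disjoint E) := by
    have key : ∀ n n', n < n' → ∀ s, s ∈ E n → s ∉ E n' := by
      intro n n' hlt s h h'
      obtain ⟨m, rfl⟩ := Nat.exists_eq_add_of_lt hlt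
      exact h.2 (m + 1) (by omega) h'.1
    intro n n' hne
    refine Set.disjoint_left.2 fun s h h' => ?_
    rcases lt_or_gt_of_ne hne with hlt | hlt
    · exact key n n' hlt s h h'
    · exact key n' n hlt s h' h
  have hhit : hitProb (K : Set (Fin d → ℤ)) x = stepsLaw d (⋃ n, E n) := by
    refine measure_congr ?_
    filter_upwards [ae_eventually_walk_notMem K x hG] with s hs
    refine propext ⟨?_, ?_⟩
    · rintro ⟨n, hn⟩
      obtain ⟨M, hM⟩ := Filter.eventually_atTop.1 hs
      have hnM : n ≤ M := by
        by_contra hlt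
        exact hM n (by omega) hn
      set m := Nat.findGreatest (fun k => walk x s k ∈ K) M with hm
      refine Set.mem_iUnion.2 ⟨m, Nat.findGreatest_spec (P := fun k => walk x s k ∈ K) hnM hn, ?_⟩
      intro k hk hmem
      by_cases hle : m + k ≤ M
      · exact Nat.findGreatest_is_greatest (P := fun k => walk x s k ∈ K)
          (show Nat.findGreatest _ M < m + k by omega) hle hmem
      · exact hM _ (by omega) hmem
    · intro h
      obtain ⟨n, hn⟩ := Set.mem_iUnion.1 h
      exact ⟨n, hn.1⟩
  rw [hhit, measure_iUnion hdisj hEm]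
  simp_rw [hν]
  rw [Summable.tsum_finsetSum (fun _ _ => ENNReal.summable)]
  simp_rw [ENNReal.tsum_mul_right]
  rfl

/-- By last exit, both sides are the double sum of `escape K x * green x y * escape K' y`, and the
Green function is symmetric. -/
lemma sum_escape_mul_hitProb_comm (K K' : Finset (Fin d → ℤ)) (hG : ∀ x y : Fin d → ℤ, green x y ≠ ∞) :
    ∑ x ∈ K, escape (K : Set (Fin d → ℤ)) x * hitProb (K' : Set (Fin d → ℤ)) x =
      ∑ x ∈ K', escape (K' : Set (Fin d → ℤ)) x * hitProb (K : Set (Fin d → ℤ)) x := by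
  simp_rw [fun x => hitProb_eq_sum K x (hG x), fun x => hitProb_eq_sum K' x (hG x), Finset.mul_sum]
  rw [Finset.sum_comm]
  refine Finset.sum_congr rfl fun y _ => Finset.sum_congr rfl fun x _ => ?_
  rw [green_comm x y]
  ring

/-! ### A superharmonic function and decay of the Green function -/

/-- The Taylor coefficient of `u ^ 2` is `10 / 64`; the excess `1 / 64` absorbs the higher orders
for small `u`. -/
lemma one_add_rpow_neg_quarter_le {u : ℝ} (hu : |u| ≤ 1 / 20) :
    (1 + u) ^ (-(1 / 4) : ℝ) ≤ 1 - u / 4 + 11 / 64 * u ^ 2 := by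
  obtain ⟨h1, h2⟩ := abs_le.1 hu
  set q := 1 - u / 4 + 11 / 64 * u ^ 2 with hq
  have hq0 : 0 < q := by nlinarith [sq_nonneg u]
  have hkey : 1 ≤ (1 + u) * q ^ 4 := by
    -- `p` plays the same role for the exponent `-1/2`, whose second order coefficient is `3 / 8 < 2
    -- / 5`. It splits the inequality of degree nine into two easy ones.
    set p := 1 - u / 2 + 2 / 5 * u ^ 2 with hp
    have hp0 : 0 < p := by nlinarith [sq_nonneg u]
    have hpq : p ≤ q ^ 2 := by
      have : q ^ 2 - p = u ^ 2 * (1 / 160 - 11 / 128 * u + 121 / 4096 * u ^ 2) := by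
        rw [hq, hp]; ring
      have : 0 ≤ u ^ 2 * (1 / 160 - 11 / 128 * u + 121 / 4096 * u ^ 2) :=
        mul_nonneg (sq_nonneg u) (by nlinarith [sq_nonneg u])
      linarith
    have hpu : 1 ≤ (1 + u) * p ^ 2 := by
      have : (1 + u) * p ^ 2 - 1 =
          u ^ 2 * (1 / 20 + 13 / 20 * u - 6 / 25 * u ^ 2 + 4 / 25 * u ^ 3) := by
        rw [hp]; ring
      have : 0 ≤ u ^ 2 * (1 / 20 + 13 / 20 * u - 6 / 25 * u ^ 2 + 4 / 25 * u ^ 3) :=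
        mul_nonneg (sq_nonneg u) (by nlinarith [sq_nonneg u, sq_abs u])
      linarith
    calc 1 ≤ (1 + u) * p ^ 2 := hpu
      _ ≤ (1 + u) * (q ^ 2) ^ 2 := by gcongr; linarith
      _ = (1 + u) * q ^ 4 := by ring
  have hu0 : 0 < 1 + u := by linarith
  rw [Real.rpow_neg hu0.le]
  rw [inv_le_comm₀ (by positivity) hq0]
  have : q⁻¹ = ((q⁻¹) ^ (4 : ℕ)) ^ (1 / 4 : ℝ) := by
    rw [← Real.rpow_natCast, ← Real.rpow_mul (by positivity)]
    norm_num
  rw [this]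
  refine Real.rpow_le_rpow (by positivity) ?_ (by norm_num)
  rw [inv_pow, inv_le_iff_one_le_mul₀ (by positivity)]
  exact hkey

/-- A shifted squared Euclidean norm. -/
noncomputable def shiftSq (x : Fin d → ℤ) : ℝ := 500 + d + ∑ i, (x i : ℝ) ^ 2

lemma shiftSq_ge (x : Fin d → ℤ) : (500 : ℝ) + d ≤ shiftSq x := by
  unfold shiftSq
  have : 0 ≤ ∑ i, (x i : ℝ) ^ 2 := Finset.sum_nonneg fun i _ => sq_nonneg _
  linarith

lemma shiftSq_pos (x : Fin d → ℤ) : 0 < shiftSq x :=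
  lt_of_lt_of_le (by positivity) (shiftSq_ge x)

lemma shiftSq_ge_sq (x : Fin d → ℤ) (i : Fin d) : (500 : ℝ) + (x i : ℝ) ^ 2 ≤ shiftSq x := by
  unfold shiftSq
  have : (x i : ℝ) ^ 2 ≤ ∑ i, (x i : ℝ) ^ 2 :=
    Finset.single_le_sum (f := fun i => (x i : ℝ) ^ 2) (fun i _ => sq_nonneg _) (Finset.mem_univ i)
  have : (0 : ℝ) ≤ d := by positivity
  linarith

lemma shiftSq_add_unitStep (x : Fin d → ℤ) (e : Fin d × Bool) :
    shiftSq (x + unitStep e) = shiftSq x + (1 + 2 * (if e.2 then 1 else -1) * x e.1) := by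
  unfold shiftSq unitStep
  have : ∀ i, (((x + Pi.single e.1 (if e.2 then 1 else -1) : Fin d → ℤ) i : ℤ) : ℝ) ^ 2 =
      (x i : ℝ) ^ 2 + if i = e.1 then 1 + 2 * (if e.2 then 1 else -1) * (x e.1 : ℝ) else 0 := by
    intro i
    by_cases h : i = e.1
    · subst h
      cases e.2 <;> simp <;> ring
    · simp [h]
  simp_rw [this, Finset.sum_add_distrib]
  simp [add_assoc]

/-- A positive superharmonic function on `ℤ^d`, `d ≥ 3`. -/
noncomputable def superharm (x : Fin d → ℤ) : ℝ := shiftSq x ^ (-(1 / 4) : ℝ)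

lemma superharm_pos (x : Fin d → ℤ) : 0 < superharm x := Real.rpow_pos_of_pos (shiftSq_pos x) _

/-- The function behaves like `|x| ^ (-1/2)`, whose decay is slower than that of the Green function.
This leaves room for a strict inequality from a second order expansion. -/
lemma sum_superharm_le (hd : 3 ≤ d) (x : Fin d → ℤ) :
    ∑ e, superharm (x + unitStep e) ≤ superharm x * (2 * d - 1 / (8 * shiftSq x)) := by
  set A := shiftSq x with hA
  have hA0 : 0 < A := shiftSq_pos x
  set u : Fin d × Bool → ℝ := fun e => (1 + 2 * (if e.2 then 1 else -1) * x e.1) / A with hu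
  -- This is where the shift `500` comes from: `20 + 40 |a| ≤ 500 + a ^ 2` for every real `a`.
  have hub : ∀ e, |u e| ≤ 1 / 20 := by
    intro e
    have h := shiftSq_ge_sq x e.1
    simp only [hu]
    rw [abs_div, abs_of_pos hA0, div_le_iff₀ hA0, abs_le]
    cases e.2 <;> simp <;> constructor <;>
      nlinarith [sq_nonneg ((x e.1 : ℝ) - 20), sq_nonneg ((x e.1 : ℝ) + 20)]
  have hstep : ∀ e, superharm (x + unitStep e) ≤
      superharm x * (1 - u e / 4 + 11 / 64 * (u e) ^ 2) := by
    intro e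
    have : shiftSq (x + unitStep e) = A * (1 + u e) := by
      rw [shiftSq_add_unitStep]
      simp only [hu]
      field_simp
      rfl
    unfold superharm
    rw [this, Real.mul_rpow hA0.le (by linarith [(abs_le.1 (hub e)).1])]
    exact mul_le_mul_of_nonneg_left (one_add_rpow_neg_quarter_le (hub e))
      (Real.rpow_nonneg hA0.le _)
  refine (Finset.sum_le_sum fun e _ => hstep e).trans ?_
  rw [← Finset.mul_sum]
  refine mul_le_mul_of_nonneg_left ?_ (superharm_pos x).le
  have hs : ∑ e, (1 - u e / 4 + 11 / 64 * (u e) ^ 2) =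
      2 * d - (d / 2) / A + 11 / 64 * ((2 * d + 8 * ∑ i, (x i : ℝ) ^ 2) / A ^ 2) := by
    rw [Fintype.sum_prod_type]
    have : ∀ i : Fin d, ∑ b : Bool, (1 - u (i, b) / 4 + 11 / 64 * (u (i, b)) ^ 2) =
        2 - 1 / 2 / A + 11 / 64 * (2 / A ^ 2 + 8 / A ^ 2 * (x i : ℝ) ^ 2) := by
      intro i
      simp [hu]
      field_simp
      ring
    simp_rw [this, Finset.sum_add_distrib, ← Finset.mul_sum, Finset.sum_add_distrib,
      ← Finset.mul_sum]
    simp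
    ring
  rw [hs]
  have hS : ∑ i, (x i : ℝ) ^ 2 = A - (500 + d) := by rw [hA]; unfold shiftSq; ring
  have hd' : (3 : ℝ) ≤ d := by exact_mod_cast hd
  have h1 : (2 * d + 8 * ∑ i, (x i : ℝ) ^ 2) / A ^ 2 ≤ 8 / A := by
    rw [div_le_div_iff₀ (by positivity) hA0, hS]
    nlinarith
  have h2 : (d / 2 : ℝ) / A ≥ (3 / 2) / A := by gcongr
  have h3 : 1 / (8 * A) = (1 / 8) / A := by field_simp
  -- The gain `d / 2 ≥ 12 / 8` beats the loss `11 / 8`; this is the use of `d ≥ 3`.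
  have h4 : 2 * (d : ℝ) - (d / 2) / A + 11 / 64 * (8 / A) ≤ 2 * d - (1 / 8) / A := by
    have : (3 / 2) / A = 11 / 64 * (8 / A) + (1 / 8) / A := by field_simp; norm_num
    linarith
  rw [h3]
  linarith

/-- Potential comparison: a positive function that loses at least `η` on average at the origin, and
gains nowhere, dominates `η` times the expected number of visits to the origin. -/
lemma green_zero_mul_le (hd : 3 ≤ d) (x : Fin d → ℤ) :
    green x 0 * ENNReal.ofReal (superharm (0 : Fin d → ℤ) / (16 * d * (500 + d))) ≤
      ENNReal.ofReal (superharm x) := by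
  set η := superharm (0 : Fin d → ℤ) / (16 * d * (500 + d)) with hη
  have hd0 : (0 : ℝ) < d := by positivity
  have hη0 : 0 ≤ η := div_nonneg (superharm_pos _).le (by positivity)
  have hstep : ∀ x : Fin d → ℤ, (2 * d : ℝ≥0∞)⁻¹ * ∑ e, ENNReal.ofReal (superharm (x + unitStep e)) +
      (if x = 0 then 1 else 0) * ENNReal.ofReal η ≤ ENNReal.ofReal (superharm x) := by
    intro x
    have h := sum_superharm_le hd x
    have e1 : (2 * d : ℝ≥0∞)⁻¹ = ENNReal.ofReal (2 * d : ℝ)⁻¹ := by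
      rw [ENNReal.ofReal_inv_of_pos (by positivity), ENNReal.ofReal_mul (by norm_num)]
      simp
    rw [← ENNReal.ofReal_sum_of_nonneg (fun e _ => (superharm_pos _).le), e1,
      ← ENNReal.ofReal_mul (by positivity)]
    have e2 : (if x = 0 then 1 else 0) * ENNReal.ofReal η =
        ENNReal.ofReal ((if x = 0 then 1 else 0) * η) := by split_ifs <;> simp
    rw [e2, ← ENNReal.ofReal_add (mul_nonneg (by positivity)
      (Finset.sum_nonneg fun e _ => (superharm_pos _).le)) (by split_ifs <;> simp [hη0])]
    refine ENNReal.ofReal_le_ofReal ?_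
    have hle : (2 * d : ℝ)⁻¹ * ∑ e, superharm (x + unitStep e) ≤
        superharm x - superharm x / (16 * d * shiftSq x) := by
      refine (mul_le_mul_of_nonneg_left h (by positivity)).trans (le_of_eq ?_)
      have := shiftSq_pos x
      field_simp
      ring
    split_ifs with hx
    · subst hx
      have : shiftSq (0 : Fin d → ℤ) = 500 + d := by simp [shiftSq]
      rw [this] at hle
      simp only [hη] at *
      linarith
    · have : 0 ≤ superharm x / (16 * d * shiftSq x) :=
        div_nonneg (superharm_pos _).le (by have := shiftSq_pos x; positivity)
      linarith
  have hsum : ∀ (M : ℕ) (x : Fin d → ℤ), (∑ n ∈ Finset.range M, transProb n x 0) *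
      ENNReal.ofReal η ≤ ENNReal.ofReal (superharm x) := by
    intro M
    induction M with
    | zero => simp
    | succ M ih =>
      intro x
      refine le_trans ?_ (hstep x)
      rw [Finset.sum_range_succ', add_mul, transProb_zero]
      refine add_le_add ?_ le_rfl
      simp_rw [transProb_succ]
      rw [← Finset.mul_sum, Finset.sum_comm, mul_assoc, Finset.sum_mul]
      gcongr with e
      exact ih _
  unfold green
  rw [← ENNReal.tsum_mul_right]
  refine ENNReal.tsum_le_of_sum_range_le fun M => ?_
  rw [← Finset.sum_mul]
  exact hsum M x

lemma green_eq_green_sub (x y : Fin d → ℤ) : green x y = green (x - y) 0 := by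
  unfold green
  refine tsum_congr fun n => ?_
  rw [← transProb_add_right n (x - y) 0 y]
  simp

/-- The Green function is bounded and decays polynomially. -/
lemma exists_green_le (hd : 3 ≤ d) : ∃ C : ℝ, 0 < C ∧
    (∀ x y : Fin d → ℤ, green x y ≤ ENNReal.ofReal C) ∧
    ∀ (x y : Fin d → ℤ) (a : ℕ) (i : Fin d), 1 ≤ a → ((a : ℤ) ^ 2) < |x i - y i| →
      green x y ≤ ENNReal.ofReal (C / a) := by
  set η := superharm (0 : Fin d → ℤ) / (16 * d * (500 + d)) with hη
  have hd0 : (0 : ℝ) < d := by positivity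
  have hη0 : 0 < η := div_pos (superharm_pos _) (by positivity)
  have hg : ∀ x y : Fin d → ℤ, green x y ≤ ENNReal.ofReal (superharm (x - y) / η) := by
    intro x y
    rw [green_eq_green_sub, ENNReal.ofReal_div_of_pos hη0, ENNReal.le_div_iff_mul_le
      (Or.inl (by simpa using hη0)) (Or.inl ENNReal.ofReal_ne_top)]
    exact green_zero_mul_le hd _
  have hle : ∀ (x : Fin d → ℤ) (b : ℝ), 0 < b → b ^ (4 : ℕ) ≤ shiftSq x → superharm x ≤ 1 / b := by
    intro x b hb h
    unfold superharm
    rw [Real.rpow_neg (shiftSq_pos x).le, one_div b]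
    refine inv_anti₀ hb ?_
    calc b = (b ^ (4 : ℕ)) ^ (1 / 4 : ℝ) := by
          rw [← Real.rpow_natCast, ← Real.rpow_mul hb.le]; norm_num
      _ ≤ _ := Real.rpow_le_rpow (by positivity) h (by norm_num)
  refine ⟨1 / η, by positivity, fun x y => (hg x y).trans (ENNReal.ofReal_le_ofReal ?_), ?_⟩
  · gcongr
    have := hle (x - y) 1 one_pos (by have := shiftSq_ge (x - y); norm_num; linarith)
    simpa using this
  · intro x y a i ha hlt
    refine (hg x y).trans (ENNReal.ofReal_le_ofReal ?_)
    have ha' : (0 : ℝ) < a := by exact_mod_cast ha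
    have := hle (x - y) a ha' (by
      have h := shiftSq_ge_sq (x - y) i
      have h' : ((a : ℝ) ^ 2) < |((x - y) i : ℤ)| := by
        have : (((a : ℤ) ^ 2 : ℤ) : ℝ) < ((|x i - y i| : ℤ) : ℝ) := by exact_mod_cast hlt
        simpa using this
      have h2 : ((a : ℝ) ^ 2) ^ 2 ≤ (|((x - y) i : ℤ)| : ℝ) ^ 2 := by
        push_cast at h'
        gcongr
      rw [sq_abs] at h2
      calc (a : ℝ) ^ 4 = ((a : ℝ) ^ 2) ^ 2 := by ring
        _ ≤ _ := h2
        _ ≤ _ := by linarith)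
    calc superharm (x - y) / η ≤ (1 / a) / η := by gcongr
      _ = 1 / η / a := by ring

/-! ### Properties of the capacity -/

lemma capacity_coe (K : Finset (Fin d → ℤ)) :
    capacity (K : Set (Fin d → ℤ)) = 2 * d * ∑ x ∈ K, escapeProb (K : Set (Fin d → ℤ)) x := by
  unfold capacity
  rw [tsum_eq_sum (s := K), Finset.mul_sum]
  · exact Finset.sum_congr rfl fun x hx => Set.indicator_of_mem (Finset.mem_coe.2 hx) _
  · exact fun x hx => Set.indicator_of_notMem (by simpa using hx) _

lemma escapeProb_nonneg (K : Set (Fin d → ℤ)) (x : Fin d → ℤ) : 0 ≤ escapeProb K x :=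
  measureReal_nonneg

lemma escapeProb_le_one (K : Set (Fin d → ℤ)) (x : Fin d → ℤ) : escapeProb K x ≤ 1 :=
  measureReal_le_one

lemma escapeProb_anti {K K' : Set (Fin d → ℤ)} (h : K ⊆ K') (x : Fin d → ℤ) :
    escapeProb K' x ≤ escapeProb K x :=
  ENNReal.toReal_mono (measure_ne_top _ _) (escape_anti h x)

lemma sum_escape_eq (K : Finset (Fin d → ℤ)) :
    ∑ x ∈ K, escape (K : Set (Fin d → ℤ)) x =
      ENNReal.ofReal (∑ x ∈ K, escapeProb (K : Set (Fin d → ℤ)) x) := by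
  rw [ENNReal.ofReal_sum_of_nonneg (fun x _ => escapeProb_nonneg _ x)]
  exact Finset.sum_congr rfl fun x _ => (ENNReal.ofReal_toReal (measure_ne_top _ _)).symm

lemma capacity_le_card (K : Finset (Fin d → ℤ)) :
    capacity (K : Set (Fin d → ℤ)) ≤ 2 * d * K.card := by
  rw [capacity_coe]
  gcongr
  exact (Finset.sum_le_card_nsmul K _ 1 fun x _ => escapeProb_le_one _ x).trans (by simp)

lemma capacity_union_le [DecidableEq (Fin d → ℤ)] (K K' : Finset (Fin d → ℤ)) :
    capacity ((K ∪ K' : Finset (Fin d → ℤ)) : Set (Fin d → ℤ)) ≤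
      capacity (K : Set (Fin d → ℤ)) + capacity (K' : Set (Fin d → ℤ)) := by
  simp only [capacity_coe]
  rw [← mul_add]
  refine mul_le_mul_of_nonneg_left ?_ (by positivity)
  calc ∑ x ∈ K ∪ K', escapeProb ((K ∪ K' : Finset (Fin d → ℤ)) : Set (Fin d → ℤ)) x
      ≤ ∑ x ∈ K, escapeProb ((K ∪ K' : Finset (Fin d → ℤ)) : Set (Fin d → ℤ)) x +
        ∑ x ∈ K', escapeProb ((K ∪ K' : Finset (Fin d → ℤ)) : Set (Fin d → ℤ)) x := by
        rw [← Finset.sum_union_inter]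
        exact le_add_of_nonneg_right (Finset.sum_nonneg fun x _ => escapeProb_nonneg _ x)
    _ ≤ _ := add_le_add
        (Finset.sum_le_sum fun x _ => escapeProb_anti (by simp) x)
        (Finset.sum_le_sum fun x _ => escapeProb_anti (by simp) x)

lemma green_ne_top (hd : 3 ≤ d) (x y : Fin d → ℤ) : green x y ≠ ∞ := by
  obtain ⟨C, -, hC, -⟩ := exists_green_le hd
  exact ((hC x y).trans_lt ENNReal.ofReal_lt_top).ne

/-- If `S` separates `K` from infinity, then a set of vertices at distance at most one from `K` has
capacity at most `2d` times that of `S`. -/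
lemma capacity_le_mul_capacity (hd : 3 ≤ d) (K : Set (Fin d → ℤ)) (K' S F : Finset (Fin d → ℤ))
    (hK' : ∀ x ∈ K', x ∈ K ∨ ∃ e, x + unitStep e ∈ K)
    (hS : ∀ x ∈ K, ∀ s : ℕ → Fin d × Bool, (∀ᶠ n in Filter.atTop, walk x s n ∉ F) →
      ∃ n, walk x s n ∈ S) :
    capacity (K' : Set (Fin d → ℤ)) ≤ 2 * d * capacity (S : Set (Fin d → ℤ)) := by
  have hG := green_ne_top hd
  have hd0 : (0 : ℝ≥0∞) < 2 * d := by
    have : (d : ℝ≥0∞) ≠ 0 := by simp [NeZero.ne d]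
    positivity
  have hdtop : (2 * d : ℝ≥0∞) ≠ ∞ := ENNReal.mul_ne_top (by simp) (by simp)
  -- By transience the walk almost surely leaves `F` for good, so `hS` applies.
  have h1 : ∀ x ∈ K, hitProb (S : Set (Fin d → ℤ)) x = 1 := by
    intro x hx
    refine (prob_compl_eq_zero_iff₀ ?_).1 ?_
    · rw [Set.ofPred_exists]
      exact (MeasurableSet.iUnion fun n => measurableSet_walk_mem x n _).nullMeasurableSet
    · refine measure_mono_null ?_ (ae_eventually_walk_notMem F x (hG x))
      intro s hs hs'
      exact hs (hS x hx s hs')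
  -- A neighbour of `K` steps into `K` with probability at least `1 / (2d)`. This is the price for
  -- passing to the closure.
  have h2 : ∀ x ∈ K', 1 ≤ 2 * d * hitProb (S : Set (Fin d → ℤ)) x := by
    intro x hx
    rcases hK' x hx with h | ⟨e, h⟩
    · rw [h1 x h, mul_one]
      have : 1 ≤ d := NeZero.one_le
      exact_mod_cast (by omega : 1 ≤ 2 * d)
    · have : (2 * d : ℝ≥0∞)⁻¹ ≤ hitProb (S : Set (Fin d → ℤ)) x := by
        unfold hitProb
        have hm : MeasurableSet {s : ℕ → Fin d × Bool |
            ∃ n : ℕ, walk x s n ∈ (S : Set (Fin d → ℤ))} := by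
          rw [Set.ofPred_exists]
          exact MeasurableSet.iUnion fun n => measurableSet_walk_mem x n _
        rw [stepsLaw_eq_sum hm]
        conv_lhs => rw [← mul_one (2 * d : ℝ≥0∞)⁻¹]
        gcongr
        rw [← h1 _ h]
        refine le_trans ?_ (Finset.single_le_sum (fun _ _ => zero_le) (Finset.mem_univ e))
        refine measure_mono ?_
        rintro s ⟨n, hn⟩
        exact ⟨n + 1, by rw [walk_seqCons]; exact hn⟩
      calc (1 : ℝ≥0∞) = 2 * d * (2 * d : ℝ≥0∞)⁻¹ := (ENNReal.mul_inv_cancel hd0.ne' hdtop).symm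
        _ ≤ _ := by gcongr
  have h3 : ∑ x ∈ K', escape (K' : Set (Fin d → ℤ)) x ≤
      2 * d * ∑ x ∈ S, escape (S : Set (Fin d → ℤ)) x := by
    calc ∑ x ∈ K', escape (K' : Set (Fin d → ℤ)) x
        ≤ ∑ x ∈ K', 2 * d * (escape (K' : Set (Fin d → ℤ)) x *
            hitProb (S : Set (Fin d → ℤ)) x) := by
          refine Finset.sum_le_sum fun x hx => ?_
          calc escape (K' : Set (Fin d → ℤ)) x = escape (K' : Set (Fin d → ℤ)) x * 1 := by simp
            _ ≤ escape (K' : Set (Fin d → ℤ)) x *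
              (2 * d * hitProb (S : Set (Fin d → ℤ)) x) := by gcongr; exact h2 x hx
            _ = _ := by ring
      _ = 2 * d * ∑ x ∈ S, escape (S : Set (Fin d → ℤ)) x * hitProb (K' : Set (Fin d → ℤ)) x := by
          rw [← Finset.mul_sum, sum_escape_mul_hitProb_comm K' S hG]
      _ ≤ _ := by
          gcongr with x
          exact (mul_le_mul_right (hitProb_le_one _ x) _).trans (by simp)
  rw [sum_escape_eq, sum_escape_eq, show (2 * d : ℝ≥0∞) = ENNReal.ofReal (2 * d : ℝ) by
    rw [ENNReal.ofReal_mul (by norm_num)]; simp, ← ENNReal.ofReal_mul (by positivity)] at h3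
  have h4 := (ENNReal.ofReal_le_ofReal_iff (mul_nonneg (by positivity)
    (Finset.sum_nonneg fun x _ => escapeProb_nonneg _ x))).1 h3
  rw [capacity_coe, capacity_coe]
  gcongr

/-- Summing the last exit formula for `hitProb K = 1` over the points of `K` bounds the cardinality
by the total escape probability times the largest row sum of the Green function. The row sum is cut
at distance `a ^ 2`: bounded terms inside, terms at most `C / a` outside. -/
lemma card_le_sum_escapeProb (hd : 3 ≤ d) : ∃ C : ℝ, 0 < C ∧
    ∀ (K : Finset (Fin d → ℤ)) (a : ℕ), 1 ≤ a →
      (K.card : ℝ) ≤ (∑ x ∈ K, escapeProb (K : Set (Fin d → ℤ)) x) *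
        (C * ((2 * a ^ 2 + 1) ^ d + K.card / a)) := by
  classical
  obtain ⟨C, hC0, hC, hC'⟩ := exists_green_le hd
  refine ⟨C, hC0, fun K a ha => ?_⟩
  have ha0 : (0 : ℝ) < a := by exact_mod_cast ha
  have hG := green_ne_top hd
  have hsum : ∀ x : Fin d → ℤ, ∑ y ∈ K, green y x ≤
      ENNReal.ofReal (C * ((2 * a ^ 2 + 1) ^ d + K.card / a)) := by
    intro x
    set B : Finset (Fin d → ℤ) :=
      Fintype.piFinset fun i => Finset.Icc (x i - (a : ℤ) ^ 2) (x i + (a : ℤ) ^ 2) with hB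
    have hBcard : (B.card : ℝ) = (2 * a ^ 2 + 1) ^ d := by
      rw [hB, Fintype.card_piFinset]
      simp only [Int.card_Icc]
      have : ∀ i, (x i + (a : ℤ) ^ 2 + 1 - (x i - (a : ℤ) ^ 2)).toNat = 2 * a ^ 2 + 1 := by
        intro i
        rw [show x i + (a : ℤ) ^ 2 + 1 - (x i - (a : ℤ) ^ 2) = ((2 * a ^ 2 + 1 : ℕ) : ℤ) by
          push_cast; ring]
        exact Int.toNat_natCast _
      simp [this]
    rw [← Finset.sum_filter_add_sum_filter_not K (· ∈ B)]
    have e1 : ∑ y ∈ K with y ∈ B, green y x ≤ ENNReal.ofReal (C * (2 * a ^ 2 + 1) ^ d) := by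
      calc ∑ y ∈ K with y ∈ B, green y x ≤ ∑ y ∈ B, green y x :=
            Finset.sum_le_sum_of_subset fun y hy => (Finset.mem_filter.1 hy).2
        _ ≤ ∑ y ∈ B, ENNReal.ofReal C := Finset.sum_le_sum fun y _ => hC y x
        _ = ENNReal.ofReal (C * (2 * a ^ 2 + 1) ^ d) := by
            rw [Finset.sum_const, nsmul_eq_mul, ← hBcard, mul_comm C,
              ENNReal.ofReal_mul (by positivity)]
            simp
    have e2 : ∑ y ∈ K with y ∉ B, green y x ≤ ENNReal.ofReal (C * (K.card / a)) := by
      calc ∑ y ∈ K with y ∉ B, green y x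
          ≤ ∑ y ∈ K with y ∉ B, ENNReal.ofReal (C / a) := by
            refine Finset.sum_le_sum fun y hy => ?_
            have hy' := (Finset.mem_filter.1 hy).2
            rw [hB, Fintype.mem_piFinset] at hy'
            push Not at hy'
            obtain ⟨i, hi⟩ := hy'
            refine hC' y x a i ha ?_
            rw [Finset.mem_Icc] at hi
            by_contra hle
            obtain ⟨h1, h2⟩ := abs_le.1 (not_lt.1 hle)
            exact hi ⟨by linarith, by linarith⟩
        _ ≤ ∑ y ∈ K, ENNReal.ofReal (C / a) :=
            Finset.sum_le_sum_of_subset (Finset.filter_subset _ _)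
        _ = _ := by
            rw [Finset.sum_const, nsmul_eq_mul,
              show C * ((K.card : ℝ) / a) = K.card * (C / a) by ring,
              ENNReal.ofReal_mul (by positivity)]
            simp
    rw [mul_add, ENNReal.ofReal_add (by positivity) (by positivity)]
    exact add_le_add e1 e2
  have h1 : ∀ y ∈ K, hitProb (K : Set (Fin d → ℤ)) y = 1 := fun y hy => by
    unfold hitProb
    rw [show {s : ℕ → Fin d × Bool | ∃ n : ℕ, walk y s n ∈ (K : Set (Fin d → ℤ))} = Set.univ from
      Set.eq_univ_of_forall fun s => ⟨0, by simpa [walk_zero] using hy⟩]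
    exact measure_univ
  have h2 : (K.card : ℝ≥0∞) ≤ (∑ x ∈ K, escape (K : Set (Fin d → ℤ)) x) *
      ENNReal.ofReal (C * ((2 * a ^ 2 + 1) ^ d + K.card / a)) := by
    calc (K.card : ℝ≥0∞) = ∑ y ∈ K, hitProb (K : Set (Fin d → ℤ)) y := by
          rw [Finset.sum_congr rfl h1]; simp
      _ = ∑ x ∈ K, escape (K : Set (Fin d → ℤ)) x * ∑ y ∈ K, green y x := by
          simp_rw [fun y => hitProb_eq_sum K y (hG y)]
          rw [Finset.sum_comm]
          simp_rw [Finset.mul_sum, mul_comm]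
      _ ≤ _ := by
          rw [Finset.sum_mul]
          gcongr with x
          exact hsum x
  rw [sum_escape_eq, ← ENNReal.ofReal_mul (Finset.sum_nonneg fun x _ => escapeProb_nonneg _ x),
    ← ENNReal.ofReal_natCast] at h2
  exact (ENNReal.ofReal_le_ofReal_iff (mul_nonneg
    (Finset.sum_nonneg fun x _ => escapeProb_nonneg _ x) (by positivity))).1 h2

/-- The cardinality of a set is at most polynomial in its capacity. -/
lemma exists_card_le_of_capacity_lt (hd : 3 ≤ d) : ∃ C : ℝ, 0 < C ∧
    ∀ (K : Finset (Fin d → ℤ)) (N : ℕ), 1 ≤ N → capacity (K : Set (Fin d → ℤ)) < N →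
      (K.card : ℝ) ≤ C * (N : ℝ) ^ (2 * d + 1) := by
  obtain ⟨C, hC0, hC⟩ := card_le_sum_escapeProb hd
  obtain ⟨b, hb⟩ := exists_nat_gt (max C 1)
  have hbC : C ≤ b := (le_max_left _ _).trans hb.le
  have hb1 : (1 : ℝ) ≤ b := (le_max_right _ _).trans hb.le
  have hb1' : 1 ≤ b := by exact_mod_cast hb1
  refine ⟨2 * C * (3 * b ^ 2) ^ d, by positivity, fun K N hN hcap => ?_⟩
  have hN' : (1 : ℝ) ≤ N := by exact_mod_cast hN
  have hd' : (3 : ℝ) ≤ d := by exact_mod_cast hd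
  rw [capacity_coe] at hcap
  set E := ∑ x ∈ K, escapeProb (K : Set (Fin d → ℤ)) x with hE
  have hE0 : 0 ≤ E := Finset.sum_nonneg fun x _ => escapeProb_nonneg _ x
  have hEN : E ≤ N / 2 := by nlinarith
  -- With this cut the far part of the bound is at most half the cardinality and is absorbed on the
  -- left.
  have h := hC K (b * N) (Nat.mul_pos hb1' hN)
  push_cast at h
  have h1 : E * (C * ((2 * (b * N : ℝ) ^ 2 + 1) ^ d + K.card / (b * N))) ≤
      N / 2 * (C * ((3 * (b * N : ℝ) ^ 2) ^ d + K.card / (b * N))) := by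
    have : (1 : ℝ) ≤ (b * N) ^ 2 := one_le_pow₀ (by nlinarith)
    gcongr
    linarith
  have h2 : (N : ℝ) / 2 * (C * (K.card / (b * N))) ≤ K.card / 2 := by
    rw [show (N : ℝ) / 2 * (C * (K.card / (b * N))) = (K.card / 2) * (C / b) by field_simp]
    exact mul_le_of_le_one_right (by positivity) ((div_le_one (by linarith)).2 hbC)
  have h3 : (N : ℝ) / 2 * (C * (3 * (b * N : ℝ) ^ 2) ^ d) =
      (C * (3 * b ^ 2) ^ d * (N : ℝ) ^ (2 * d + 1)) / 2 := by
    rw [mul_pow (b : ℝ), ← mul_assoc 3, mul_pow (3 * (b : ℝ) ^ 2), ← pow_mul (N : ℝ)]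
    ring
  have h4 : (0 : ℝ) ≤ C * (3 * b ^ 2) ^ d * (N : ℝ) ^ (2 * d + 1) := by positivity
  have := h.trans h1
  rw [mul_add, mul_add, h3] at this
  nlinarith

end RandomWalk

/-! ### Boxes and their parents in the dyadic hierarchy -/

section Boxes

variable {d : ℕ}

/-- The index of the box of scale `L` containing `x`. -/
def boxIndex (L : ℕ+) (x : Fin d → ℤ) : Fin d → ℤ := fun i => x i / (L : ℤ)

lemma mem_verts_iff (L : ℕ+) (z x : Fin d → ℤ) : x ∈ (Box.mk L z).verts ↔ boxIndex L x = z := by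
  have hL : (0 : ℤ) < L := by exact_mod_cast L.pos
  simp only [Box.verts, Set.mem_ofPred_eq, funext_iff, boxIndex]
  refine forall_congr' fun i => ?_
  rw [Int.ediv_eq_iff_of_pos hL]
  constructor <;> rintro ⟨h1, h2⟩ <;> constructor <;> linarith

lemma mem_coarse_iff (C : Set (Fin d → ℤ)) (L : ℕ+) (z : Fin d → ℤ) :
    z ∈ coarse C L ↔ ∃ x ∈ C, boxIndex L x = z := by
  constructor
  · rintro ⟨x, hx, hC⟩
    exact ⟨x, hC, (mem_verts_iff L z x).1 hx⟩
  · rintro ⟨x, hC, hx⟩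
    exact ⟨x, (mem_verts_iff L z x).2 hx, hC⟩

lemma coarse_eq_image (C : Set (Fin d → ℤ)) (L : ℕ+) : coarse C L = boxIndex L '' C := by
  ext z
  exact mem_coarse_iff C L z

/-- The vertices of a box, as a finite set. -/
noncomputable def Box.vertsFinset (B : Box d) : Finset (Fin d → ℤ) :=
  Fintype.piFinset fun i => Finset.Ico ((B.scale : ℤ) * B.index i)
    ((B.scale : ℤ) * B.index i + (B.scale : ℤ))

lemma Box.coe_vertsFinset (B : Box d) : (B.vertsFinset : Set (Fin d → ℤ)) = B.verts := by
  ext x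
  simp [Box.vertsFinset, Box.verts]

lemma Box.card_vertsFinset (B : Box d) : B.vertsFinset.card = (B.scale : ℕ) ^ d := by
  simp [Box.vertsFinset, Fintype.card_piFinset]

/-- The index of the box of scale `2 * L` containing a given box of scale `L`. -/
def parent (z : Fin d → ℤ) : Fin d → ℤ := fun i => z i / 2

lemma boxIndex_two_mul {L L' : ℕ+} (h : (L' : ℕ) = L * 2) (x : Fin d → ℤ) :
    boxIndex L' x = parent (boxIndex L x) := by
  funext i
  simp only [boxIndex, parent]
  rw [show ((L' : ℕ+) : ℤ) = (L : ℤ) * 2 by exact_mod_cast h,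
    ← Int.ediv_ediv_of_nonneg (by positivity)]

/-- The indices of the `2 ^ d` children of a set of boxes. -/
noncomputable def children (D : Finset (Fin d → ℤ)) : Finset (Fin d → ℤ) :=
  D.biUnion fun z => Fintype.piFinset fun i => Finset.Icc (2 * z i) (2 * z i + 1)

lemma mem_children {D : Finset (Fin d → ℤ)} {z : Fin d → ℤ} (h : parent z ∈ D) :
    z ∈ children D := by
  refine Finset.mem_biUnion.2 ⟨_, h, ?_⟩
  rw [Fintype.mem_piFinset]
  intro i
  rw [Finset.mem_Icc]
  simp only [parent]
  omega

lemma card_children_le (D : Finset (Fin d → ℤ)) : (children D).card ≤ 2 ^ d * D.card := by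
  refine Finset.card_biUnion_le.trans ?_
  rw [mul_comm, ← smul_eq_mul]
  refine Finset.sum_le_card_nsmul _ _ _ fun z _ => ?_
  simp [Fintype.card_piFinset, show ∀ a : ℤ, 2 * a + 1 + 1 - 2 * a = 2 from fun a => by ring]

lemma lattice_adj_iff (x y : Fin d → ℤ) :
    (lattice d).Adj x y ↔ ∃ e, y = x + unitStep e := by
  constructor
  · intro h
    have h : ∑ i, |x i - y i| = 1 := h
    obtain ⟨i, hi⟩ : ∃ i, x i - y i ≠ 0 := by
      by_contra! h0
      simp [h0] at h
    have hsum := Finset.add_sum_erase Finset.univ (fun i => |x i - y i|) (Finset.mem_univ i)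
    have hnn : ∀ j ∈ Finset.univ.erase i, 0 ≤ |x j - y j| := fun j _ => abs_nonneg _
    have h0 := Finset.sum_nonneg hnn
    have h1 : 1 ≤ |x i - y i| := Int.one_le_abs hi
    have hz : ∑ j ∈ Finset.univ.erase i, |x j - y j| = 0 := by omega
    have hi1 : |x i - y i| = 1 := by omega
    rw [Finset.sum_eq_zero_iff_of_nonneg hnn] at hz
    refine ⟨(i, decide (y i - x i = 1)), ?_⟩
    funext j
    simp only [unitStep, Pi.add_apply]
    by_cases hj : j = i
    · subst hj
      rw [Pi.single_eq_same]
      rcases (abs_eq one_pos.le).1 hi1 with h | h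
      · rw [if_neg (by simp; omega)]; omega
      · rw [if_pos (by simp; omega)]; omega
    · rw [Pi.single_eq_of_ne hj]
      have := abs_eq_zero.1 (hz j (Finset.mem_erase.2 ⟨hj, Finset.mem_univ j⟩))
      omega
  · rintro ⟨e, rfl⟩
    change ∑ i, |x i - (x + unitStep e) i| = 1
    rw [Finset.sum_eq_single e.1]
    · cases h : e.2 <;> simp [unitStep, h]
    · intro j _ hj
      simp [unitStep, Pi.single_eq_of_ne hj]
    · simp

lemma boxIndex_eq_or_adj (L : ℕ+) (x : Fin d → ℤ) (e : Fin d × Bool) :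
    boxIndex L (x + unitStep e) = boxIndex L x ∨
      (lattice d).Adj (boxIndex L x) (boxIndex L (x + unitStep e)) := by
  have hL : (0 : ℤ) < L := by exact_mod_cast L.pos
  have hne : ∀ j, j ≠ e.1 → boxIndex L (x + unitStep e) j = boxIndex L x j := fun j hj => by
    simp [boxIndex, unitStep, Pi.single_eq_of_ne hj]
  have heq : |boxIndex L x e.1 - boxIndex L (x + unitStep e) e.1| ≤ 1 := by
    set a := x e.1 with ha
    set b := a + (if e.2 then 1 else -1) with hb
    have e1 : boxIndex L (x + unitStep e) e.1 = b / L := by simp [boxIndex, unitStep, hb, ha]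
    have e2 : boxIndex L x e.1 = a / L := rfl
    rw [e1, e2]
    have hb1 : b ≤ a + 1 := by rw [hb]; split_ifs <;> omega
    have hb2 : a - 1 ≤ b := by rw [hb]; split_ifs <;> omega
    have h1 := Int.ediv_le_ediv hL (show b ≤ a + L by omega)
    have h2 := Int.ediv_le_ediv hL (show a ≤ b + L by omega)
    rw [Int.add_ediv_of_dvd_right (dvd_refl _), Int.ediv_self hL.ne'] at h1 h2
    rw [abs_le]
    constructor <;> omega
  by_cases h : boxIndex L x e.1 = boxIndex L (x + unitStep e) e.1
  · left
    funext j
    by_cases hj : j = e.1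
    · rw [hj, h]
    · exact hne j hj
  · right
    change ∑ i, |boxIndex L x i - boxIndex L (x + unitStep e) i| = 1
    rw [Finset.sum_eq_single e.1]
    · have := Int.one_le_abs (sub_ne_zero.2 h)
      omega
    · intro j _ hj
      rw [hne j hj]; simp
    · simp

end Boxes

/-! ### Counting the outcomes of the exploration -/

section Counting

variable {d : ℕ}

open Classical in
/-- The boxes found in the first `n + 1` generations. -/
noncomputable def gather (sc : ℕ → ℕ+) (V : ℕ → Finset (Fin d → ℤ)) (n : ℕ) : Finset (Box d) :=
  (Finset.range (n + 1)).biUnion fun i => (V i).image (Box.mk (sc i))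

lemma mem_gather {sc : ℕ → ℕ+} {V : ℕ → Finset (Fin d → ℤ)} {n : ℕ} {B : Box d} :
    B ∈ gather sc V n ↔ ∃ i ≤ n, ∃ z ∈ V i, Box.mk (sc i) z = B := by
  simp [gather]

/-- `D` and `V` describe an exploration of `n` generations: in each generation, `D` and `V` consist
of children of the boxes of `D` in the previous generation, which are at most `m` many. -/
structure IsExploration (top : Finset (Fin d → ℤ)) (m : ℕ → ℝ) (n : ℕ)
    (D V : ℕ → Finset (Fin d → ℤ)) : Prop where
  left_zero : D 0 ⊆ top
  right_zero : V 0 ⊆ top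
  left_succ : ∀ i < n, D (i + 1) ⊆ children (D i)
  right_succ : ∀ i < n, V (i + 1) ⊆ children (D i)
  card_le : ∀ i < n, ((D i).card : ℝ) ≤ m i

lemma IsExploration.mono {top : Finset (Fin d → ℤ)} {m : ℕ → ℝ} {n n' : ℕ}
    {D V : ℕ → Finset (Fin d → ℤ)} (h : IsExploration top m n D V) (hn : n' ≤ n) :
    IsExploration top m n' D V :=
  ⟨h.1, h.2, fun i hi => h.3 i (hi.trans_le hn), fun i hi => h.4 i (hi.trans_le hn),
    fun i hi => h.5 i (hi.trans_le hn)⟩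

lemma card_children_le_of_card_le {D : Finset (Fin d → ℤ)} {a : ℝ} (h : (D.card : ℝ) ≤ a) :
    ((children D).card : ℝ) ≤ 2 ^ d * a := by
  have : ((children D).card : ℝ) ≤ 2 ^ d * D.card := by exact_mod_cast card_children_le D
  exact this.trans (by gcongr)

/-- No threshold is imposed on generation `n` itself; its size is controlled through its parents.
This bounds the interface taken at the first generation exceeding its threshold. -/
lemma IsExploration.card_left_le {top : Finset (Fin d → ℤ)} {m : ℕ → ℝ} {n : ℕ}
    {D V : ℕ → Finset (Fin d → ℤ)} (hm : ∀ i, 0 ≤ m i) (h : IsExploration top m n D V) :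
    ((D n).card : ℝ) ≤ top.card + 2 ^ d * ∑ i ∈ Finset.range n, m i := by
  cases n with
  | zero => simpa using Finset.card_le_card h.left_zero
  | succ n =>
    have h1 : ((D (n + 1)).card : ℝ) ≤ 2 ^ d * m n :=
      le_trans (by exact_mod_cast Finset.card_le_card (h.left_succ n n.lt_succ_self))
        (card_children_le_of_card_le (h.card_le n n.lt_succ_self))
    have h2 : m n ≤ ∑ i ∈ Finset.range (n + 1), m i :=
      Finset.single_le_sum (f := m) (fun i _ => hm i) (Finset.self_mem_range_succ n)
    have h3 : (0 : ℝ) ≤ top.card := by positivity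
    have : (2 : ℝ) ^ d * m n ≤ 2 ^ d * ∑ i ∈ Finset.range (n + 1), m i := by gcongr
    linarith

lemma IsExploration.card_gather_le {top : Finset (Fin d → ℤ)} {m : ℕ → ℝ} {n : ℕ}
    {D V : ℕ → Finset (Fin d → ℤ)} (sc : ℕ → ℕ+) (h : IsExploration top m n D V) :
    ((gather sc V n).card : ℝ) ≤ top.card + 2 ^ d * ∑ i ∈ Finset.range n, m i := by
  classical
  have h1 : ((gather sc V n).card : ℝ) ≤ ∑ i ∈ Finset.range (n + 1), ((V i).card : ℝ) := by
    have : (gather sc V n).card ≤ ∑ i ∈ Finset.range (n + 1), (V i).card :=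
      Finset.card_biUnion_le.trans (Finset.sum_le_sum fun i _ => Finset.card_image_le)
    exact_mod_cast this
  refine h1.trans ?_
  rw [Finset.sum_range_succ', add_comm, Finset.mul_sum]
  refine add_le_add (by exact_mod_cast Finset.card_le_card h.right_zero)
    (Finset.sum_le_sum fun i hi => ?_)
  have hi := Finset.mem_range.1 hi
  exact le_trans (by exact_mod_cast Finset.card_le_card (h.right_succ i hi))
    (card_children_le_of_card_le (h.card_le i hi))

/-- Given `D n`, the next pair consists of two subsets of a set of at most `2 ^ d * m n` children,
hence the factor `4 ^ (2 ^ d * m n)`. The last bad generation is recorded beside the gathered boxes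
because it determines where the exploration continues. -/
lemma exists_finset_of_isExploration (top : Finset (Fin d → ℤ)) (sc : ℕ → ℕ+) (m : ℕ → ℝ)
    (n : ℕ) : ∃ G : Finset (Finset (Fin d → ℤ) × Finset (Box d)),
      (G.card : ℝ) ≤ 4 ^ ((top.card : ℝ) + 2 ^ d * ∑ i ∈ Finset.range n, m i) ∧
      ∀ D V : ℕ → Finset (Fin d → ℤ), IsExploration top m n D V → (D n, gather sc V n) ∈ G := by
  classical
  induction n with
  | zero =>
    refine ⟨(top.powerset ×ˢ top.powerset).image
      fun p => (p.1, p.2.image (Box.mk (sc 0))), ?_, ?_⟩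
    · simp only [Finset.range_zero, Finset.sum_empty, mul_zero, add_zero, Real.rpow_natCast]
      have h := Finset.card_image_le (s := top.powerset ×ˢ top.powerset)
        (f := fun p => (p.1, p.2.image (Box.mk (sc 0))))
      rw [Finset.card_product, Finset.card_powerset, ← mul_pow] at h
      exact_mod_cast h
    · intro D V h
      refine Finset.mem_image.2 ⟨(D 0, V 0), ?_, ?_⟩
      · simp [h.left_zero, h.right_zero]
      · simp [gather]
  | succ n ih =>
    obtain ⟨G, hcard, hG⟩ := ih
    refine ⟨(G.filter fun p => (p.1.card : ℝ) ≤ m n).biUnion fun p =>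
      ((children p.1).powerset ×ˢ (children p.1).powerset).image
        fun q => (q.1, p.2 ∪ q.2.image (Box.mk (sc (n + 1)))), ?_, ?_⟩
    · have h1 : ∀ p ∈ G.filter fun p => (p.1.card : ℝ) ≤ m n,
          ((((children p.1).powerset ×ˢ (children p.1).powerset).image
            fun q => (q.1, p.2 ∪ q.2.image (Box.mk (sc (n + 1))))).card : ℝ) ≤
            4 ^ (2 ^ d * m n) := by
        intro p hp
        have h := Finset.card_image_le (s := (children p.1).powerset ×ˢ (children p.1).powerset)
          (f := fun q => (q.1, p.2 ∪ q.2.image (Box.mk (sc (n + 1)))))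
        rw [Finset.card_product, Finset.card_powerset, ← mul_pow] at h
        calc _ ≤ ((((2 * 2) ^ (children p.1).card : ℕ)) : ℝ) := by exact_mod_cast h
          _ = (4 : ℝ) ^ ((children p.1).card : ℝ) := by
            rw [Real.rpow_natCast]; push_cast; norm_num
          _ ≤ _ := Real.rpow_le_rpow_of_exponent_le (by norm_num)
            (card_children_le_of_card_le (Finset.mem_filter.1 hp).2)
      calc _ ≤ ∑ p ∈ G.filter fun p => (p.1.card : ℝ) ≤ m n,
            ((((children p.1).powerset ×ˢ (children p.1).powerset).image
            fun q => (q.1, p.2 ∪ q.2.image (Box.mk (sc (n + 1))))).card : ℝ) := by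
            exact_mod_cast Finset.card_biUnion_le
        _ ≤ (G.filter fun p => (p.1.card : ℝ) ≤ m n).card * (4 : ℝ) ^ (2 ^ d * m n) := by
            rw [← nsmul_eq_mul]
            exact Finset.sum_le_card_nsmul _ _ _ h1
        _ ≤ G.card * (4 : ℝ) ^ (2 ^ d * m n) := by
            gcongr
            exact Finset.filter_subset _ _
        _ ≤ 4 ^ ((top.card : ℝ) + 2 ^ d * ∑ i ∈ Finset.range n, m i) *
            (4 : ℝ) ^ (2 ^ d * m n) := by gcongr
        _ = _ := by
            rw [← Real.rpow_add (by norm_num), Finset.sum_range_succ]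
            ring_nf
    · intro D V h
      refine Finset.mem_biUnion.2 ⟨(D n, gather sc V n), Finset.mem_filter.2
        ⟨hG D V (h.mono n.le_succ), h.card_le n n.lt_succ_self⟩, Finset.mem_image.2
        ⟨(D (n + 1), V (n + 1)), ?_, ?_⟩⟩
      · simp [h.left_succ n n.lt_succ_self, h.right_succ n n.lt_succ_self]
      · simp only [Prod.mk.injEq, true_and]
        conv_rhs => rw [gather, Finset.range_add_one, Finset.biUnion_insert, Finset.union_comm]
        rfl

end Counting

/-! ### Exploration of the bad boxes of a finite set -/

section Exploration

variable {d : ℕ}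

/-- The bad boxes of `C` of the `n`-th generation: all their ancestors are bad too. -/
def badSet (C : Set (Fin d → ℤ)) (sc : ℕ → ℕ+) (b : Box d → Prop) : ℕ → Set (Fin d → ℤ)
  | 0 => {z | z ∈ coarse C (sc 0) ∧ b ⟨sc 0, z⟩}
  | n + 1 => {z | z ∈ coarse C (sc (n + 1)) ∧ b ⟨sc (n + 1), z⟩ ∧ parent z ∈ badSet C sc b n}

/-- The very bad boxes of `C` of the `n`-th generation: all their ancestors are bad. -/
def veryBadSet (C : Set (Fin d → ℤ)) (sc : ℕ → ℕ+) (b vb : Box d → Prop) : ℕ → Set (Fin d → ℤ)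
  | 0 => {z | z ∈ coarse C (sc 0) ∧ vb ⟨sc 0, z⟩}
  | n + 1 => {z | z ∈ coarse C (sc (n + 1)) ∧ vb ⟨sc (n + 1), z⟩ ∧ parent z ∈ badSet C sc b n}

variable {C : Set (Fin d → ℤ)} {sc : ℕ → ℕ+} {b vb : Box d → Prop}

lemma badSet_subset (n : ℕ) : badSet C sc b n ⊆ coarse C (sc n) := by
  cases n with
  | zero => exact fun z hz => hz.1
  | succ n => exact fun z hz => hz.1

lemma veryBadSet_subset (n : ℕ) : veryBadSet C sc b vb n ⊆ coarse C (sc n) := by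
  cases n with
  | zero => exact fun z hz => hz.1
  | succ n => exact fun z hz => hz.1

lemma of_mem_badSet {n : ℕ} {z : Fin d → ℤ} (h : z ∈ badSet C sc b n) : b ⟨sc n, z⟩ := by
  cases n with
  | zero => exact h.2
  | succ n => exact h.2.1

lemma of_mem_veryBadSet {n : ℕ} {z : Fin d → ℤ} (h : z ∈ veryBadSet C sc b vb n) :
    vb ⟨sc n, z⟩ := by
  cases n with
  | zero => exact h.2
  | succ n => exact h.2.1

lemma coarse_finite (hC : C.Finite) (L : ℕ+) : (coarse C L).Finite := by
  rw [coarse_eq_image]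
  exact hC.image _

/-- Ancestors of a bad box are bad. -/
lemma boxIndex_mem_badSet {k : ℕ} (hsc : ∀ i < k, (sc i : ℕ) = sc (i + 1) * 2) {i j : ℕ}
    (hij : i ≤ j) (hj : j ≤ k) {x : Fin d → ℤ} (h : boxIndex (sc j) x ∈ badSet C sc b j) :
    boxIndex (sc i) x ∈ badSet C sc b i := by
  induction j, hij using Nat.le_induction with
  | base => exact h
  | succ j hij ih =>
    refine ih (by omega) ?_
    rw [boxIndex_two_mul (hsc j (by omega))]
    exact h.2.2

lemma boxIndex_mem_badSet_of_mem_veryBadSet {k : ℕ} (hsc : ∀ i < k, (sc i : ℕ) = sc (i + 1) * 2)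
    {i j : ℕ} (hij : i < j) (hj : j ≤ k) {x : Fin d → ℤ}
    (h : boxIndex (sc j) x ∈ veryBadSet C sc b vb j) :
    boxIndex (sc i) x ∈ badSet C sc b i := by
  obtain ⟨j, rfl⟩ := Nat.exists_eq_add_of_lt hij
  refine boxIndex_mem_badSet hsc (j := i + j) (by omega) (by omega) ?_
  rw [boxIndex_two_mul (hsc (i + j) (by omega))]
  exact h.2.2

/-- The very bad boxes found by the exploration are disjoint. -/
lemma disjoint_verts_of_mem_veryBadSet {k : ℕ} (hsc : ∀ i < k, (sc i : ℕ) = sc (i + 1) * 2)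
    (hdisj : ∀ B, b B → ¬ vb B) {i j : ℕ} (hi : i ≤ k) (hj : j ≤ k) {z w : Fin d → ℤ}
    (hz : z ∈ veryBadSet C sc b vb i) (hw : w ∈ veryBadSet C sc b vb j)
    (hne : Box.mk (sc i) z ≠ Box.mk (sc j) w) :
    Disjoint (Box.mk (sc i) z).verts (Box.mk (sc j) w).verts := by
  refine Set.disjoint_left.2 fun x hx hx' => ?_
  rw [mem_verts_iff] at hx hx'
  subst hx hx'
  rcases lt_trichotomy i j with h | rfl | h
  -- The larger of two overlapping boxes would be an ancestor of the smaller, hence bad as well as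
  -- very bad.
  · exact hdisj _ (of_mem_badSet (boxIndex_mem_badSet_of_mem_veryBadSet hsc h hj hw))
      (of_mem_veryBadSet hz)
  · exact hne rfl
  · exact hdisj _ (of_mem_badSet (boxIndex_mem_badSet_of_mem_veryBadSet hsc h hi hz))
      (of_mem_veryBadSet hw)

/-- A path to infinity that avoids the very bad boxes stays within bad boxes as long as it is in
boxes of `C`. -/
lemma boxIndex_mem_badSet_of_path {k : ℕ} (hsc : ∀ i < k, (sc i : ℕ) = sc (i + 1) * 2)
    (hinit : ∀ i ≤ k, ∀ z ∈ innerBoundary (lattice d) (coarse C (sc i)),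
      b ⟨sc i, z⟩ ∨ vb ⟨sc i, z⟩)
    (hprop : ∀ i ≤ k, ∀ z ∈ coarse C (sc i), ∀ z' ∈ coarse C (sc i), (lattice d).Adj z z' →
      b ⟨sc i, z⟩ → b ⟨sc i, z'⟩ ∨ vb ⟨sc i, z'⟩)
    (w : ℕ → Fin d → ℤ) (hw : ∀ n, ∃ e, w (n + 1) = w n + unitStep e)
    (hfin : ∀ᶠ n in Filter.atTop, boxIndex (sc 0) (w n) ∉ coarse C (sc 0))
    (havoid : ∀ i ≤ k, ∀ n, boxIndex (sc i) (w n) ∉ veryBadSet C sc b vb i) :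
    ∀ i ≤ k, ∀ n, boxIndex (sc i) (w n) ∈ coarse C (sc i) →
      boxIndex (sc i) (w n) ∈ badSet C sc b i := by
  have key : ∀ i ≤ k, (∀ᶠ n in Filter.atTop, boxIndex (sc i) (w n) ∉ coarse C (sc i)) →
      (∀ n, boxIndex (sc i) (w n) ∈ coarse C (sc i) → b ⟨sc i, boxIndex (sc i) (w n)⟩ →
        boxIndex (sc i) (w n) ∈ badSet C sc b i) →
      (∀ n, boxIndex (sc i) (w n) ∈ coarse C (sc i) → vb ⟨sc i, boxIndex (sc i) (w n)⟩ →
        boxIndex (sc i) (w n) ∈ veryBadSet C sc b vb i) →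
      ∀ n, boxIndex (sc i) (w n) ∈ coarse C (sc i) →
        boxIndex (sc i) (w n) ∈ badSet C sc b i := by
    intro i hi hev hb hvb n
    obtain ⟨T, hT⟩ := Filter.eventually_atTop.1 hev
    -- Induction backwards in time from `T`, after which the path has left the boxes meeting `C`.
    -- Initiation starts the chain at each exit, propagation carries it to earlier times.
    have main : ∀ p n, T ≤ n + p → boxIndex (sc i) (w n) ∈ coarse C (sc i) →
        boxIndex (sc i) (w n) ∈ badSet C sc b i := by
      intro p
      induction p with
      | zero => exact fun n hn hmem => absurd hmem (hT n hn)
      | succ p ih =>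
        intro n hn hmem
        have hor : b ⟨sc i, boxIndex (sc i) (w n)⟩ ∨ vb ⟨sc i, boxIndex (sc i) (w n)⟩ := by
          obtain ⟨e, he⟩ := hw n
          have hadj := boxIndex_eq_or_adj (sc i) (w n) e
          rw [← he] at hadj
          by_cases hnext : boxIndex (sc i) (w (n + 1)) ∈ coarse C (sc i)
          · have hbad := ih (n + 1) (by omega) hnext
            rcases hadj with h | h
            · rw [h] at hbad
              exact Or.inl (of_mem_badSet hbad)
            · exact hprop i hi _ hnext _ hmem h.symm (of_mem_badSet hbad)
          · rcases hadj with h | h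
            · exact absurd (h ▸ hmem) hnext
            · exact hinit i hi _ ⟨hmem, _, hnext, h⟩
        rcases hor with h | h
        · exact hb n hmem h
        · exact absurd (hvb n hmem h) (havoid i hi n)
    exact main T n (by omega)
  intro i
  induction i with
  | zero =>
    intro hi
    exact key 0 hi hfin (fun n h h' => ⟨h, h'⟩) (fun n h h' => ⟨h, h'⟩)
  | succ i ih =>
    intro hi
    have hpar : ∀ x : Fin d → ℤ, boxIndex (sc i) x = parent (boxIndex (sc (i + 1)) x) :=
      boxIndex_two_mul (hsc i (by omega))
    have hup : ∀ x, boxIndex (sc (i + 1)) x ∈ coarse C (sc (i + 1)) →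
        boxIndex (sc i) x ∈ coarse C (sc i) := by
      intro x hx
      obtain ⟨y, hy, hyx⟩ := (mem_coarse_iff _ _ _).1 hx
      exact (mem_coarse_iff _ _ _).2 ⟨y, hy, by rw [hpar, hyx, ← hpar]⟩
    -- The result at the coarser scale provides the bad parents that membership in generation `i +
    -- 1` requires.
    have hbad : ∀ n, boxIndex (sc (i + 1)) (w n) ∈ coarse C (sc (i + 1)) →
        parent (boxIndex (sc (i + 1)) (w n)) ∈ badSet C sc b i := fun n hn => by
      rw [← hpar]
      exact ih (by omega) n (hup _ hn)
    refine key (i + 1) hi ?_ (fun n h h' => ⟨h, h', hbad n h⟩) (fun n h h' => ⟨h, h', hbad n h⟩)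
    have h0 : ∀ j ≤ i + 1, ∀ x, boxIndex (sc j) x ∈ coarse C (sc j) →
        boxIndex (sc 0) x ∈ coarse C (sc 0) := by
      intro j
      induction j with
      | zero => exact fun _ x hx => hx
      | succ j ihj =>
        intro hj x hx
        refine ihj (by omega) x ?_
        obtain ⟨y, hy, hyx⟩ := (mem_coarse_iff _ _ _).1 hx
        exact (mem_coarse_iff _ _ _).2 ⟨y, hy, by
          rw [boxIndex_two_mul (hsc j (by omega)), hyx, ← boxIndex_two_mul (hsc j (by omega))]⟩
    filter_upwards [hfin] with n hn hmem
    exact hn (h0 (i + 1) le_rfl _ hmem)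

end Exploration

/-! ### Clusters -/

section Cluster

variable {d : ℕ}

lemma mem_vertexClosure_iff (K : Set (Fin d → ℤ)) (x : Fin d → ℤ) :
    x ∈ vertexClosure (lattice d) K ↔ x ∈ K ∨ ∃ e, x + unitStep e ∈ K := by
  constructor
  · rintro (h | ⟨-, y, hy, hadj⟩)
    · exact Or.inl h
    · obtain ⟨e, rfl⟩ := (lattice_adj_iff x y).1 hadj
      exact Or.inr ⟨e, hy⟩
  · rintro (h | ⟨e, h⟩)
    · exact Or.inl h
    · by_cases hx : x ∈ K
      · exact Or.inl hx
      · exact Or.inr ⟨hx, _, h, (lattice_adj_iff x _).2 ⟨e, rfl⟩⟩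

lemma vertexClosure_finite {K : Set (Fin d → ℤ)} (hK : K.Finite) :
    (vertexClosure (lattice d) K).Finite := by
  refine (hK.union (Set.finite_iUnion fun e : Fin d × Bool =>
    hK.image fun y => y - unitStep e)).subset fun x hx => ?_
  rcases (mem_vertexClosure_iff K x).1 hx with h | ⟨e, h⟩
  · exact Or.inl h
  · exact Or.inr (Set.mem_iUnion.2 ⟨e, _, h, by simp⟩)

lemma unitStep_apply_le (e : Fin d × Bool) (i : Fin d) : |unitStep e i| ≤ 1 := by
  unfold unitStep
  by_cases h : i = e.1
  · subst h
    rw [Pi.single_eq_same]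
    split_ifs <;> simp
  · rw [Pi.single_eq_of_ne h]; simp

lemma zero_mem_cluster {f : (Fin d → ℤ) → ℝ} {h : ℝ} (hne : (cluster f h).Nonempty) :
    (0 : Fin d → ℤ) ∈ cluster f h := by
  obtain ⟨x, h0, -, -⟩ := hne
  exact ⟨h0, h0, SimpleGraph.Reachable.refl _⟩

lemma abs_sub_le_length_of_walk {s : Set (Fin d → ℤ)} {u v : s}
    (p : ((lattice d).induce s).Walk u v) (i : Fin d) :
    |(v : Fin d → ℤ) i - (u : Fin d → ℤ) i| ≤ p.length := by
  induction p with
  | nil => simp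
  | @cons u v w hadj p ih =>
    rw [SimpleGraph.Walk.length_cons]
    obtain ⟨e, he⟩ := (lattice_adj_iff _ _).1 hadj
    have h1 : |(v : Fin d → ℤ) i - (u : Fin d → ℤ) i| ≤ 1 := by
      have : (v : Fin d → ℤ) i = (u : Fin d → ℤ) i + unitStep e i := congrFun he i
      rw [this]
      simpa using unitStep_apply_le e i
    have h2 := abs_sub_le ((w : Fin d → ℤ) i) ((v : Fin d → ℤ) i) ((u : Fin d → ℤ) i)
    push_cast
    linarith

/-- The radius of a finite cluster is at most its cardinality. -/
lemma abs_le_card_of_mem_cluster {f : (Fin d → ℤ) → ℝ} {h : ℝ} (hfin : (cluster f h).Finite)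
    {x : Fin d → ℤ} (hx : x ∈ cluster f h) (i : Fin d) : |x i| ≤ hfin.toFinset.card := by
  classical
  obtain ⟨h0, hxs, hr⟩ := hx
  obtain ⟨p, hp⟩ := hr.exists_isPath
  have h1 := abs_sub_le_length_of_walk p i
  have h2 : p.support.map Subtype.val ⊆ hfin.toFinset.toList := by
    intro y hy
    obtain ⟨y', hy', rfl⟩ := List.mem_map.1 hy
    rw [Finset.mem_toList, Set.Finite.mem_toFinset]
    exact ⟨h0, y'.2, ⟨p.takeUntil y' hy'⟩⟩
  have h3 := (List.subperm_of_subset (hp.support_nodup.map Subtype.val_injective) h2).length_le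
  rw [List.length_map, SimpleGraph.Walk.length_support, Finset.length_toList] at h3
  simp only [Pi.zero_apply, sub_zero] at h1
  have : (p.length : ℤ) ≤ hfin.toFinset.card := by exact_mod_cast (by omega)
  linarith

lemma abs_le_diam_of_mem_cluster {f : (Fin d → ℤ) → ℝ} {h : ℝ} (hfin : (cluster f h).Finite)
    {x : Fin d → ℤ} (hx : x ∈ cluster f h) (i : Fin d) :
    (|x i| : ℝ) ≤ Metric.diam (cluster f h) := by
  have h1 := Metric.dist_le_diam_of_mem hfin.isBounded hx (zero_mem_cluster ⟨x, hx⟩)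
  have h2 := (dist_le_pi_dist x 0 i).trans h1
  simpa [Int.norm_eq_abs] using h2

lemma diam_cluster_le {f : (Fin d → ℤ) → ℝ} {h : ℝ} (hfin : (cluster f h).Finite) :
    Metric.diam (cluster f h) ≤ 2 * hfin.toFinset.card := by
  refine Metric.diam_le_of_forall_dist_le (by positivity) fun x hx y hy => ?_
  refine (dist_pi_le_iff (by positivity)).2 fun i => ?_
  have h1 : (|x i| : ℝ) ≤ hfin.toFinset.card := by
    exact_mod_cast abs_le_card_of_mem_cluster hfin hx i
  have h2 : (|y i| : ℝ) ≤ hfin.toFinset.card := by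
    exact_mod_cast abs_le_card_of_mem_cluster hfin hy i
  rw [Int.dist_eq]
  calc |(x i : ℝ) - y i| ≤ |(x i : ℝ)| + |(y i : ℝ)| := abs_sub _ _
    _ ≤ _ := by linarith

end Cluster

/-! ### Capacity of the explored boxes -/

/-- A walk from `C` to infinity meets a gathered very bad box or else starts in a bad box of the
last generation. The two kinds of boxes together thus block `C`, and the bad ones are bounded by
their volume. -/
lemma capacity_vertexClosure_le {d : ℕ} (hd : 3 ≤ d) {C : Set (Fin d → ℤ)} (hC : C.Finite)
    {sc : ℕ → ℕ+} {b vb : Box d → Prop} {k : ℕ}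
    (hsc : ∀ i < k, (sc i : ℕ) = sc (i + 1) * 2)
    (hinit : ∀ i ≤ k, ∀ z ∈ innerBoundary (lattice d) (coarse C (sc i)),
      b ⟨sc i, z⟩ ∨ vb ⟨sc i, z⟩)
    (hprop : ∀ i ≤ k, ∀ z ∈ coarse C (sc i), ∀ z' ∈ coarse C (sc i), (lattice d).Adj z z' →
      b ⟨sc i, z⟩ → b ⟨sc i, z'⟩ ∨ vb ⟨sc i, z'⟩)
    (D V : ℕ → Finset (Fin d → ℤ)) (hD : ∀ i, (D i : Set (Fin d → ℤ)) = badSet C sc b i)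
    (hV : ∀ i, (V i : Set (Fin d → ℤ)) = veryBadSet C sc b vb i) :
    capacity (vertexClosure (lattice d) C) ≤
      2 * d * (capacity (⋃ B ∈ gather sc V k, B.verts) + 2 * d * ((sc k : ℕ) ^ d * (D k).card)) := by
  classical
  have : NeZero d := ⟨by omega⟩
  set SV : Finset (Fin d → ℤ) := (gather sc V k).biUnion Box.vertsFinset with hSV
  set SD : Finset (Fin d → ℤ) := (D k).biUnion fun z => (Box.mk (sc k) z).vertsFinset with hSD
  set F : Finset (Fin d → ℤ) :=
    (coarse_finite hC (sc 0)).toFinset.biUnion fun z => (Box.mk (sc 0) z).vertsFinset with hF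
  have memV : ∀ (B : Box d) x, x ∈ B.vertsFinset ↔ x ∈ B.verts := fun B x => by
    rw [← Box.coe_vertsFinset, Finset.mem_coe]
  have hSVc : (SV : Set (Fin d → ℤ)) = ⋃ B ∈ gather sc V k, B.verts := by
    rw [hSV, Finset.coe_biUnion]
    simp [Box.coe_vertsFinset]
  have hSDcard : (SD.card : ℝ) ≤ (sc k : ℕ) ^ d * (D k).card := by
    have : SD.card ≤ (D k).card • (sc k : ℕ) ^ d :=
      Finset.card_biUnion_le.trans
        (Finset.sum_le_card_nsmul _ _ _ fun z _ => (Box.card_vertsFinset _).le)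
    rw [smul_eq_mul, mul_comm] at this
    exact_mod_cast this
  have hfin := vertexClosure_finite hC
  have hsep : ∀ x ∈ C, ∀ s : ℕ → Fin d × Bool, (∀ᶠ n in Filter.atTop, walk x s n ∉ F) →
      ∃ n, walk x s n ∈ SV ∪ SD := by
    intro x hx s hs
    by_contra! hno
    have havoid : ∀ i ≤ k, ∀ n, boxIndex (sc i) (walk x s n) ∉ veryBadSet C sc b vb i := by
      intro i hi n hmem
      rw [← hV, Finset.mem_coe] at hmem
      refine hno n (Finset.mem_union_left _ (Finset.mem_biUnion.2
        ⟨_, mem_gather.2 ⟨i, hi, _, hmem, rfl⟩, ?_⟩))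
      rw [memV, mem_verts_iff]
    have h := boxIndex_mem_badSet_of_path hsc hinit hprop (walk x s)
      (fun n => ⟨s n, by simp [walk, Finset.sum_range_succ, add_assoc]⟩)
      (hs.mono fun n hn hmem => hn (Finset.mem_biUnion.2
        ⟨_, (coarse_finite hC (sc 0)).mem_toFinset.2 hmem, by rw [memV, mem_verts_iff]⟩))
      havoid k le_rfl 0 ((mem_coarse_iff _ _ _).2 ⟨x, hx, by rw [walk_zero]⟩)
    rw [← hD, Finset.mem_coe] at h
    refine hno 0 (Finset.mem_union_right _ (Finset.mem_biUnion.2 ⟨_, h, ?_⟩))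
    rw [memV, mem_verts_iff]
  have hcap := capacity_le_mul_capacity hd C hfin.toFinset (SV ∪ SD) F
    (fun x hx => (mem_vertexClosure_iff C x).1 (hfin.mem_toFinset.1 hx)) hsep
  rw [Set.Finite.coe_toFinset] at hcap
  refine hcap.trans (mul_le_mul_of_nonneg_left ?_ (by positivity))
  refine (capacity_union_le SV SD).trans ?_
  rw [hSVc]
  gcongr
  exact (capacity_le_card SD).trans (by gcongr)

/-! ### Counting interfaces -/

lemma exists_finset_boxes {d : ℕ} (top : Finset (Fin d → ℤ)) (sc : ℕ → ℕ → ℕ+) (m : ℕ → ℕ → ℝ)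
    (M : ℕ) (A : ℝ)
    (hA : ∀ k n, n ≤ k → (top.card : ℝ) + 2 ^ d * ∑ i ∈ Finset.range n, m k i ≤ A) :
    ∃ 𝓕 : Finset (Finset (Box d)), (𝓕.card : ℝ) ≤ 2 * (M + 1) ^ 2 * 4 ^ A ∧
      ∀ k ≤ M, ∀ n ≤ k, ∀ D V : ℕ → Finset (Fin d → ℤ), IsExploration top (m k) n D V →
        (∀ S : Finset (Box d), (∀ B, B ∈ S ↔ ∃ z ∈ D n, Box.mk (sc k n) z = B) → S ∈ 𝓕) ∧
          gather (sc k) V n ∈ 𝓕 := by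
  classical
  choose G hcard hG using fun k n => exists_finset_of_isExploration top (sc k) (m k) n
  refine ⟨(Finset.range (M + 1)).biUnion fun k => (Finset.range (k + 1)).biUnion fun n =>
    (G k n).biUnion fun p => {p.1.image (Box.mk (sc k n)), p.2}, ?_, ?_⟩
  · have h1 : ∀ k n, n ≤ k → (((G k n).biUnion fun p =>
        {p.1.image (Box.mk (sc k n)), p.2}).card : ℝ) ≤ 4 ^ A * 2 := by
      intro k n hn
      have h : ((G k n).biUnion fun p => {p.1.image (Box.mk (sc k n)), p.2}).card ≤
          (G k n).card • 2 := Finset.card_biUnion_le.trans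
        (Finset.sum_le_card_nsmul _ _ _ fun p _ => Finset.card_le_two)
      rw [smul_eq_mul] at h
      calc _ ≤ ((G k n).card : ℝ) * 2 := by exact_mod_cast h
        _ ≤ _ := by
          gcongr
          exact (hcard k n).trans (Real.rpow_le_rpow_of_exponent_le (by norm_num) (hA k n hn))
    have h2 : ∀ k ∈ Finset.range (M + 1), (((Finset.range (k + 1)).biUnion fun n =>
        (G k n).biUnion fun p => {p.1.image (Box.mk (sc k n)), p.2}).card : ℝ) ≤
        (M + 1) * (4 ^ A * 2) := by
      intro k hk
      have hk : k ≤ M := Nat.lt_succ_iff.1 (Finset.mem_range.1 hk)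
      calc _ ≤ ∑ n ∈ Finset.range (k + 1), (((G k n).biUnion fun p =>
            {p.1.image (Box.mk (sc k n)), p.2}).card : ℝ) := by
            exact_mod_cast Finset.card_biUnion_le
        _ ≤ (Finset.range (k + 1)).card • (4 ^ A * 2 : ℝ) :=
            Finset.sum_le_card_nsmul _ _ _ fun n hn =>
              h1 k n (Nat.lt_succ_iff.1 (Finset.mem_range.1 hn))
        _ ≤ _ := by
            rw [nsmul_eq_mul, Finset.card_range]
            push_cast
            gcongr
    calc _ ≤ ∑ k ∈ Finset.range (M + 1), (((Finset.range (k + 1)).biUnion fun n =>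
          (G k n).biUnion fun p => {p.1.image (Box.mk (sc k n)), p.2}).card : ℝ) := by
          exact_mod_cast Finset.card_biUnion_le
      _ ≤ (Finset.range (M + 1)).card • ((M + 1) * (4 ^ A * 2) : ℝ) :=
          Finset.sum_le_card_nsmul _ _ _ h2
      _ = _ := by
          rw [nsmul_eq_mul, Finset.card_range]
          push_cast
          ring
  · intro k hk n hn D V h
    have hmem : ∀ S ∈ ({(D n).image (Box.mk (sc k n)), gather (sc k) V n} : Finset _),
        S ∈ (Finset.range (M + 1)).biUnion fun k => (Finset.range (k + 1)).biUnion fun n =>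
          (G k n).biUnion fun p => {p.1.image (Box.mk (sc k n)), p.2} := fun S hS =>
      Finset.mem_biUnion.2 ⟨k, Finset.mem_range.2 (Nat.lt_succ_of_le hk), Finset.mem_biUnion.2
        ⟨n, Finset.mem_range.2 (Nat.lt_succ_of_le hn), Finset.mem_biUnion.2
          ⟨_, hG k n D V h, hS⟩⟩⟩
    refine ⟨fun S hS => hmem S ?_, hmem _ (by simp)⟩
    rw [Finset.mem_insert]
    left
    ext B
    rw [hS, Finset.mem_image]

/-- An interface is determined by its set of boxes, so counting box sets is enough. -/
lemma exists_finset_interface {d : ℕ} (𝓕 : Finset (Finset (Box d))) (P : Interface d → Prop) :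
    ∃ 𝓘 : Finset (Interface d), 𝓘.card ≤ 𝓕.card ∧ ∀ I, I ∈ 𝓘 ↔ I.boxes ∈ 𝓕 ∧ P I := by
  have hinj : Function.Injective (Interface.boxes : Interface d → Finset (Box d)) := by
    rintro ⟨s, _, _⟩ ⟨s', _, _⟩ h
    cases h
    rfl
  have hfin : {I : Interface d | I.boxes ∈ 𝓕 ∧ P I}.Finite :=
    (𝓕.finite_toSet.preimage hinj.injOn).subset fun I hI => hI.1
  refine ⟨hfin.toFinset, ?_, fun I => hfin.mem_toFinset⟩
  exact Finset.card_le_card_of_injOn Interface.boxes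
    (fun I hI => ((hfin.mem_toFinset).1 hI).1) hinj.injOn

/-! ### Choice of the parameters -/

/-- The dyadic scales. -/
def dyadicScale (l : ℕ+) (j : ℕ) : ℕ+ := l * 2 ^ j

lemma coe_dyadicScale (l : ℕ+) (j : ℕ) : (dyadicScale l j : ℕ) = l * 2 ^ j := by
  simp [dyadicScale]

lemma sum_dyadicScale_rpow_le (l : ℕ+) {ρ : ℝ} (hρ : 0 < ρ) {n k : ℕ} (hn : n ≤ k) :
    ∑ i ∈ Finset.range n, ((dyadicScale l (k - i) : ℕ) : ℝ) ^ (-ρ) ≤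
      ((l : ℕ) : ℝ) ^ (-ρ) / (1 - 2 ^ (-ρ)) := by
  set r : ℝ := 2 ^ (-ρ) with hr
  have hr0 : 0 ≤ r := by positivity
  have hr1 : r < 1 := Real.rpow_lt_one_of_one_lt_of_neg (by norm_num) (by linarith)
  have hterm : ∀ j, ((dyadicScale l j : ℕ) : ℝ) ^ (-ρ) = ((l : ℕ) : ℝ) ^ (-ρ) * r ^ j := by
    intro j
    rw [coe_dyadicScale]
    push_cast
    rw [Real.mul_rpow (by positivity) (by positivity), hr, ← Real.rpow_natCast, ← Real.rpow_natCast,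
      ← Real.rpow_mul (by norm_num), ← Real.rpow_mul (by norm_num), mul_comm (j : ℝ)]
  calc ∑ i ∈ Finset.range n, ((dyadicScale l (k - i) : ℕ) : ℝ) ^ (-ρ)
      ≤ ∑ i ∈ Finset.range (k + 1), ((dyadicScale l (k - i) : ℕ) : ℝ) ^ (-ρ) :=
        Finset.sum_le_sum_of_subset_of_nonneg
          (Finset.range_subset_range.2 (by omega)) fun _ _ _ => by positivity
    _ = ∑ j ∈ Finset.range (k + 1), ((dyadicScale l j : ℕ) : ℝ) ^ (-ρ) := by
        simpa using Finset.sum_range_reflect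
          (fun j => ((dyadicScale l j : ℕ) : ℝ) ^ (-ρ)) (k + 1)
    _ = ((l : ℕ) : ℝ) ^ (-ρ) * ∑ j ∈ Finset.range (k + 1), r ^ j := by
        simp_rw [hterm, Finset.mul_sum]
    _ ≤ ((l : ℕ) : ℝ) ^ (-ρ) * (1 - r)⁻¹ := by
        gcongr
        rw [← tsum_geometric_of_lt_one hr0 hr1]
        exact (summable_geometric_of_lt_one hr0 hr1).sum_le_tsum _ fun _ _ => by positivity
    _ = _ := by rw [div_eq_mul_inv]

/-- The condition does not involve `t`, since thresholds and entropy budget are both proportional to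
`t * N`. So `l` can be fixed first and `t` chosen from it. -/
lemma exists_scale (d : ℕ) {ρ δ : ℝ} (hρ : 0 < ρ) (hδ : 0 < δ) :
    ∃ l : ℕ+, 2 ^ d * (((l : ℕ) : ℝ) ^ (-ρ) / (1 - 2 ^ (-ρ))) ≤ δ / 8 := by
  have h : Filter.Tendsto (fun n : ℕ => (2 : ℝ) ^ d * ((n : ℝ) ^ (-ρ) / (1 - 2 ^ (-ρ))))
      Filter.atTop (nhds (2 ^ d * (0 / (1 - 2 ^ (-ρ))))) :=
    (((tendsto_rpow_neg_atTop hρ).comp tendsto_natCast_atTop_atTop).div_const _).const_mul _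
  rw [zero_div, mul_zero] at h
  obtain ⟨n, hn, hn0⟩ := ((h.eventually (ge_mem_nhds (show (0 : ℝ) < δ / 8 by positivity))).and
    (Filter.eventually_gt_atTop 0)).exists
  exact ⟨⟨n, hn0⟩, hn⟩

lemma exists_threshold (a b c C : ℝ) (p : ℕ) (hb : 0 < b) :
    ∃ N₀ : ℝ, 0 < N₀ ∧ ∀ N : ℕ, N₀ ≤ N → 4 ≤ (N : ℝ) ∧ a < N ∧ c ≤ b * N ∧
      2 * (C * (N : ℝ) ^ p + 1) ^ 2 ≤ Real.exp (b * N) := by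
  have h1 : ∀ q : ℕ, (fun x : ℝ => x ^ q) =o[Filter.atTop] fun x => Real.exp (b * x) :=
    fun q => isLittleO_pow_exp_pos_mul_atTop q hb
  have h2 : (fun x : ℝ => 2 * (C * x ^ p + 1) ^ 2) =o[Filter.atTop] fun x => Real.exp (b * x) := by
    have e : (fun x : ℝ => 2 * (C * x ^ p + 1) ^ 2) =
        fun x => 2 * C ^ 2 * x ^ (2 * p) + 4 * C * x ^ p + 2 * x ^ 0 := by
      funext x
      ring
    rw [e]
    exact (((h1 (2 * p)).const_mul_left _).add ((h1 p).const_mul_left _)).add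
      ((h1 0).const_mul_left _)
  have h3 : Filter.Tendsto (fun x : ℝ => b * x) Filter.atTop Filter.atTop :=
    Filter.tendsto_id.const_mul_atTop hb
  have h4 := ((Filter.eventually_ge_atTop (4 : ℝ)).and (Filter.eventually_gt_atTop a)).and
    ((h3.eventually_ge_atTop c).and (h2.bound one_pos))
  obtain ⟨N₀, hN₀⟩ := Filter.eventually_atTop.1 h4
  refine ⟨max N₀ 1, by positivity, fun N hN => ?_⟩
  obtain ⟨⟨h5, h6⟩, h7, h8⟩ := hN₀ N ((le_max_left _ _).trans hN)
  refine ⟨h5, h6, h7, ?_⟩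
  rw [one_mul, Real.norm_of_nonneg (by positivity), Real.norm_of_nonneg (Real.exp_pos _).le] at h8
  exact h8

/-! ### Clusters at the finest and the coarsest scale -/

lemma capacity_empty (d : ℕ) : capacity (∅ : Set (Fin d → ℤ)) = 0 := by
  simp [capacity, equilibriumMeasure]

/-- A finite cluster whose closure has large capacity has large diameter. -/
lemma le_diam_cluster {d : ℕ} [NeZero d] {f : (Fin d → ℤ) → ℝ} {h : ℝ}
    (hfin : (cluster f h).Finite) (l : ℕ)
    (hcap : 2 * d * (2 * (l : ℝ) + 3) ^ d < capacity (vertexClosure (lattice d) (cluster f h))) :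
    (l : ℝ) ≤ Metric.diam (cluster f h) := by
  by_contra! hlt
  have hfin' := vertexClosure_finite hfin
  have hsub : hfin'.toFinset ⊆
      Fintype.piFinset fun _ => Finset.Icc (-((l : ℤ) + 1)) ((l : ℤ) + 1) := by
    intro x hx
    rw [Fintype.mem_piFinset]
    intro i
    have key : ∀ y ∈ cluster f h, |y i| ≤ l := by
      intro y hy
      have := (abs_le_diam_of_mem_cluster hfin hy i).trans hlt.le
      exact_mod_cast this
    rw [Finset.mem_Icc, ← abs_le]
    rcases (mem_vertexClosure_iff _ x).1 (hfin'.mem_toFinset.1 hx) with hx | ⟨e, hx⟩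
    · have := key x hx
      omega
    · have h1 := key _ hx
      have h2 := unitStep_apply_le e i
      rw [Pi.add_apply] at h1
      rw [abs_le] at *
      omega
  have hcard : (hfin'.toFinset.card : ℝ) ≤ (2 * (l : ℝ) + 3) ^ d := by
    have := Finset.card_le_card hsub
    rw [Fintype.card_piFinset] at this
    simp only [Int.card_Icc, Finset.prod_const, Finset.card_univ, Fintype.card_fin,
      show (((l : ℤ) + 1) + 1 - -((l : ℤ) + 1)).toNat = 2 * l + 3 by omega] at this
    exact_mod_cast this
  have := capacity_le_card hfin'.toFinset
  rw [Set.Finite.coe_toFinset] at this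
  have h2 : 2 * (d : ℝ) * hfin'.toFinset.card ≤ 2 * d * (2 * (l : ℝ) + 3) ^ d := by gcongr
  linarith

lemma coarse_cluster_subset {d : ℕ} {f : (Fin d → ℤ) → ℝ} {h : ℝ} (hfin : (cluster f h).Finite)
    (L : ℕ+) (hL : Metric.diam (cluster f h) < 2 * ((L : ℕ) : ℝ)) {z : Fin d → ℤ}
    (hz : z ∈ coarse (cluster f h) L) :
    z ∈ Fintype.piFinset fun _ : Fin d => Finset.Icc (-2 : ℤ) 1 := by
  obtain ⟨x, hx, rfl⟩ := (mem_coarse_iff _ _ _).1 hz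
  have hL0 : (0 : ℤ) < L := by exact_mod_cast L.pos
  rw [Fintype.mem_piFinset]
  intro i
  have h1 : |x i| < 2 * ((L : ℕ) : ℤ) := by
    exact_mod_cast (abs_le_diam_of_mem_cluster hfin hx i).trans_lt hL
  rw [abs_lt] at h1
  rw [Finset.mem_Icc]
  constructor
  · exact (Int.le_ediv_iff_mul_le hL0).2 (by linarith)
  · exact Int.lt_add_one_iff.1 ((Int.ediv_lt_iff_lt_mul hL0).2 (by linarith))

end CoarseGraining

/-! ### The coarse-graining theorem -/

open CoarseGraining in
theorem theorem3p3 (d : ℕ) (hd : 3 ≤ d) (ρ δ : ℝ) (hρ : 0 < ρ) (hδ : 0 < δ) :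
    ∃ t L₀ N₀ : ℝ, 0 < t ∧ t < 1 ∧ 0 < L₀ ∧ 0 < N₀ ∧
      ∀ (Ω : Type*) (φ : Ω → (Fin d → ℤ) → ℝ) (h : ℝ) (Eb Evb : Box d → Set Ω),
        (∀ L : ℕ+, IsAdmissible φ h L Eb Evb) →
        ∀ N : ℕ, N₀ ≤ (N : ℝ) →
          ∃ 𝓘 : Finset (Interface d),
            (𝓘.card : ℝ) ≤ Real.exp (δ * t * N) ∧
            (∀ I ∈ 𝓘, L₀ ≤ ((I.minScale : ℕ) : ℝ) ∧ (I.boxes.card : ℝ) ≤ δ * t * N) ∧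
            ∀ ω ∈ capacityEvent φ h N, ∃ I ∈ 𝓘,
              I.Occurs Eb Evb ω ∧
              ((I.maxScale : ℕ) : ℝ) ≤ Metric.diam (cluster (φ ω) h) ∧
              (∀ B ∈ I.boxesWith Eb ω, B.scale = I.minScale) ∧
              ((N : ℝ) / (4 * d) ≤ capacity (⋃ B ∈ I.boxesWith Evb ω, B.verts) ∨
                t * N ≤ ((I.boxesWith Eb ω).card : ℝ) * ((I.minScale : ℕ) : ℝ) ^ ρ) := by
  classical
  have : NeZero d := ⟨by omega⟩
  have hd' : (3 : ℝ) ≤ d := by exact_mod_cast hd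
  obtain ⟨C, hC0, hC⟩ := exists_card_le_of_capacity_lt hd
  obtain ⟨l, hl⟩ := exists_scale d hρ hδ
  have hl1 : (1 : ℝ) ≤ ((l : ℕ) : ℝ) := by exact_mod_cast l.pos
  -- Chosen so that `t * N` boxes of scale `l` account for at most `N / 4` in the capacity bound.
  set t : ℝ := 1 / (16 * d ^ 2 * ((l : ℕ) : ℝ) ^ d) with ht
  have hlpow : (1 : ℝ) ≤ ((l : ℕ) : ℝ) ^ d := one_le_pow₀ hl1
  have ht0 : 0 < t := by positivity
  have ht1 : t < 1 := by
    rw [ht, div_lt_one (by positivity)]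
    nlinarith
  have htl : 16 * (d : ℝ) ^ 2 * ((l : ℕ) : ℝ) ^ d * t = 1 := by
    rw [ht]; field_simp
  obtain ⟨N₀, hN₀, hthr⟩ := exists_threshold (2 * d * (2 * ((l : ℕ) : ℝ) + 3) ^ d + 1) (δ * t / 8)
    (4 ^ d) (2 * C) (2 * d + 1) (by positivity)
  refine ⟨t, (l : ℕ), N₀, ht0, ht1, by positivity, hN₀, ?_⟩
  intro Ω φ h Eb Evb hadm N hN
  obtain ⟨hN4, hNl, hN4d, hNexp⟩ := hthr N hN
  set top : Finset (Fin d → ℤ) := Fintype.piFinset fun _ : Fin d => Finset.Icc (-2 : ℤ) 1 with htop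
  have htopcard : (top.card : ℝ) = 4 ^ d := by
    rw [htop, Fintype.card_piFinset]; simp
  -- Generation `0` is the coarsest and generation `k` has scale `l`. By truncated subtraction later
  -- generations keep scale `l`.
  set sc : ℕ → ℕ → ℕ+ := fun k i => dyadicScale l (k - i) with hsc
  set m : ℕ → ℕ → ℝ := fun k i => t * N * ((sc k i : ℕ) : ℝ) ^ (-ρ) with hm
  have hm0 : ∀ k i, 0 ≤ m k i := fun k i => by positivity
  have hA : ∀ k n, n ≤ k → (top.card : ℝ) + 2 ^ d * ∑ i ∈ Finset.range n, m k i ≤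
      δ * t * N / 4 := by
    intro k n hn
    have h1 := sum_dyadicScale_rpow_le l hρ hn
    have h2 : 2 ^ d * ∑ i ∈ Finset.range n, m k i ≤ t * N * (δ / 8) := by
      calc 2 ^ d * ∑ i ∈ Finset.range n, m k i
          = t * N * (2 ^ d * ∑ i ∈ Finset.range n, ((dyadicScale l (k - i) : ℕ) : ℝ) ^ (-ρ)) := by
            simp only [hm, hsc, ← Finset.mul_sum]
            ring
        _ ≤ t * N * (δ / 8) := by
            gcongr
            exact le_trans (by gcongr) hl
    rw [htopcard]
    linarith
  set M : ℕ := ⌊2 * C * (N : ℝ) ^ (2 * d + 1)⌋₊ with hM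
  obtain ⟨𝓕, h𝓕card, h𝓕⟩ := exists_finset_boxes top sc m M _ hA
  obtain ⟨𝓘, h𝓘card, h𝓘⟩ := exists_finset_interface 𝓕 fun I =>
    ((l : ℕ) : ℝ) ≤ ((I.minScale : ℕ) : ℝ) ∧ (I.boxes.card : ℝ) ≤ δ * t * N
  refine ⟨𝓘, ?_, fun I hI => ((h𝓘 I).1 hI).2, ?_⟩
  · have h1 : (4 : ℝ) ^ (δ * t * N / 4) ≤ Real.exp (δ * t * N / 2) := by
      have h4 : (4 : ℝ) ≤ Real.exp 2 := by
        have := Real.add_one_le_exp (1 : ℝ)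
        calc (4 : ℝ) = (1 + 1) * (1 + 1) := by norm_num
          _ ≤ Real.exp 1 * Real.exp 1 := by gcongr
          _ = Real.exp 2 := by rw [← Real.exp_add]; norm_num
      calc (4 : ℝ) ^ (δ * t * N / 4) ≤ Real.exp 2 ^ (δ * t * N / 4) :=
            Real.rpow_le_rpow (by norm_num) h4 (by positivity)
        _ = _ := by rw [← Real.exp_mul]; ring_nf
    have h2 : 2 * ((M : ℝ) + 1) ^ 2 ≤ Real.exp (δ * t / 8 * N) := by
      refine le_trans ?_ hNexp
      gcongr
      exact Nat.floor_le (by positivity)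
    calc (𝓘.card : ℝ) ≤ 𝓕.card := by exact_mod_cast h𝓘card
      _ ≤ 2 * (M + 1) ^ 2 * 4 ^ (δ * t * N / 4) := h𝓕card
      _ ≤ Real.exp (δ * t / 8 * N) * Real.exp (δ * t * N / 2) := by gcongr
      _ ≤ Real.exp (δ * t * N) := by
          rw [← Real.exp_add]
          refine Real.exp_le_exp.2 ?_
          have : 0 ≤ δ * t * N := by positivity
          linarith
  rintro ω ⟨hfin, hlow, hup⟩
  set K := cluster (φ ω) h with hK
  have hfin' := vertexClosure_finite hfin
  have hdiam : ((l : ℕ) : ℝ) ≤ Metric.diam K := le_diam_cluster hfin l (by linarith)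
  -- The coarsest scale is at most the diameter, as initiation requires, and more than half of it,
  -- so that the boxes meeting the cluster at that scale lie in the fixed set `top`.
  obtain ⟨k, hk1, hk2⟩ := exists_nat_pow_near (x := Metric.diam K / (l : ℕ)) (y := (2 : ℝ))
    ((one_le_div (by positivity)).2 hdiam) (by norm_num)
  rw [le_div_iff₀ (by positivity)] at hk1
  rw [div_lt_iff₀ (by positivity)] at hk2
  have hscale : ∀ i, ((sc k i : ℕ) : ℝ) ≤ Metric.diam K := by
    intro i
    refine le_trans ?_ hk1
    simp only [hsc, coe_dyadicScale]
    push_cast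
    rw [mul_comm]
    gcongr
    · norm_num
    · omega
  have hscale' : ∀ i, ((l : ℕ) : ℝ) ≤ ((sc k i : ℕ) : ℝ) := by
    intro i
    simp only [hsc, coe_dyadicScale]
    exact_mod_cast Nat.le_mul_of_pos_right _ (by positivity)
  have hkM : k ≤ M := by
    refine Nat.le_floor ?_
    have h1 : (k : ℝ) ≤ 2 ^ k := by exact_mod_cast Nat.lt_two_pow_self.le
    have h2 : (2 : ℝ) ^ k ≤ 2 ^ k * (l : ℕ) := le_mul_of_one_le_right (by positivity) hl1
    have h3 := diam_cluster_le hfin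
    have h4 : (hfin.toFinset.card : ℝ) ≤ hfin'.toFinset.card := by
      exact_mod_cast Finset.card_le_card
        (Set.Finite.toFinset_subset_toFinset.2 Set.subset_union_left)
    have h5 := hC hfin'.toFinset N (by
      have : (1 : ℝ) ≤ N := by linarith
      exact_mod_cast this) (by rwa [Set.Finite.coe_toFinset])
    linarith
  have hscsucc : ∀ i < k, (sc k i : ℕ) = sc k (i + 1) * 2 := by
    intro i hi
    simp only [hsc, coe_dyadicScale]
    rw [show k - i = (k - (i + 1)) + 1 by omega, pow_succ, mul_assoc]
  have hdisj : ∀ B, ω ∈ Eb B → ω ∉ Evb B := fun B hB hB' =>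
    Set.disjoint_left.1 ((hadm B.scale).disjoint B.index) hB hB'
  set D : ℕ → Finset (Fin d → ℤ) := fun i =>
    ((coarse_finite hfin (sc k i)).subset (badSet_subset (b := fun B => ω ∈ Eb B) i)).toFinset with hD
  set V : ℕ → Finset (Fin d → ℤ) := fun i => ((coarse_finite hfin (sc k i)).subset
    (veryBadSet_subset (b := fun B => ω ∈ Eb B) (vb := fun B => ω ∈ Evb B) i)).toFinset with hV
  have hDmem : ∀ i z, z ∈ D i ↔ z ∈ badSet K (sc k) (fun B => ω ∈ Eb B) i :=
    fun i z => Set.Finite.mem_toFinset _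
  have hVmem : ∀ i z, z ∈ V i ↔
      z ∈ veryBadSet K (sc k) (fun B => ω ∈ Eb B) (fun B => ω ∈ Evb B) i :=
    fun i z => Set.Finite.mem_toFinset _
  have htopsub : ∀ z ∈ coarse K (sc k 0), z ∈ top := by
    intro z hz
    refine coarse_cluster_subset hfin (sc k 0) ?_ hz
    simp only [hsc, coe_dyadicScale]
    push_cast
    rw [pow_succ] at hk2
    calc Metric.diam (cluster (φ ω) h) < 2 ^ k * 2 * (l : ℕ) := hk2
      _ = _ := by rw [Nat.sub_zero]; ring
  have hexpl : ∀ n, (∀ i < n, ((D i).card : ℝ) ≤ m k i) → IsExploration top (m k) n D V :=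
    fun n hn => ⟨fun z hz => htopsub z (badSet_subset _ ((hDmem 0 z).1 hz)),
      fun z hz => htopsub z (veryBadSet_subset _ ((hVmem 0 z).1 hz)),
      fun i _ z hz => mem_children ((hDmem i _).2 ((hDmem (i + 1) z).1 hz).2.2),
      fun i _ z hz => mem_children ((hDmem i _).2 ((hVmem (i + 1) z).1 hz).2.2), hn⟩
  have hδtN : 0 ≤ δ * t * N := by positivity
  have hmemF : ∀ (I : Interface d) (E : Box d → Set Ω) B,
      B ∈ I.boxesWith E ω ↔ B ∈ I.boxes ∧ ω ∈ E B := fun I E B => by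
    simp [Interface.boxesWith]
  by_cases hcase : ∃ n, n ≤ k ∧ m k n < (D n).card
  · -- the bad boxes of the first generation with many of them
    obtain ⟨hnk, hnm⟩ := Nat.find_spec hcase
    have hmin : ∀ i < Nat.find hcase, ((D i).card : ℝ) ≤ m k i := fun i hi => by
      have := Nat.find_min hcase hi
      push Not at this
      exact this (by omega)
    set n := Nat.find hcase with hn
    have hex := hexpl n hmin
    have hDcard : 0 < (D n).card := by
      have := (hm0 k n).trans_lt hnm
      exact_mod_cast this
    have hmemS : ∀ B, B ∈ (D n).image (Box.mk (sc k n)) ↔ ∃ z ∈ D n, Box.mk (sc k n) z = B :=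
      fun B => Finset.mem_image
    have hinj : Function.Injective (Box.mk (d := d) (sc k n)) := fun z z' hzz => by
      simpa using hzz
    set I : Interface d := ⟨(D n).image (Box.mk (sc k n)), (Finset.card_pos.1 hDcard).image _, by
      intro B hB B' hB' hne
      obtain ⟨z, hz, rfl⟩ := (hmemS B).1 hB
      obtain ⟨z', hz', rfl⟩ := (hmemS B').1 hB'
      refine Set.disjoint_left.2 fun x hx hx' => hne ?_
      rw [mem_verts_iff] at hx hx'
      rw [← hx, ← hx']⟩ with hI
    have hbad : ∀ B ∈ I.boxes, ω ∈ Eb B ∧ B.scale = sc k n := by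
      intro B hB
      obtain ⟨z, hz, rfl⟩ := (hmemS B).1 hB
      exact ⟨of_mem_badSet ((hDmem n z).1 hz), rfl⟩
    have hminS : I.minScale = sc k n := by
      obtain ⟨B, hB, h1⟩ := Finset.exists_mem_eq_inf' I.nonempty Box.scale
      exact h1.trans (hbad B hB).2
    have hmaxS : I.maxScale = sc k n := by
      obtain ⟨B, hB, h1⟩ := Finset.exists_mem_eq_sup' I.nonempty Box.scale
      exact h1.trans (hbad B hB).2
    have hcardI : I.boxes.card = (D n).card := Finset.card_image_of_injective _ hinj
    refine ⟨I, (h𝓘 I).2 ⟨(h𝓕 k hkM n hnk D V hex).1 _ hmemS, ?_, ?_⟩,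
      fun B hB => Or.inl (hbad B hB).1, ?_, ?_, Or.inr ?_⟩
    · rw [hminS]; exact hscale' n
    · rw [hcardI]
      have := (hex.card_left_le (hm0 k)).trans (hA k n hnk)
      linarith
    · rw [hmaxS]; exact hscale n
    · intro B hB
      rw [hminS]
      exact (hbad B ((hmemF I Eb B).1 hB).1).2
    · have : I.boxesWith Eb ω = I.boxes := by
        ext B
        rw [hmemF]
        exact ⟨fun h => h.1, fun h => ⟨h, (hbad B h).1⟩⟩
      rw [this, hcardI, hminS]
      have hs0 : (0 : ℝ) < (sc k n : ℕ) := by positivity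
      calc t * N = m k n * ((sc k n : ℕ) : ℝ) ^ ρ := by
            simp only [hm]
            rw [mul_assoc, ← Real.rpow_add hs0]
            simp
        _ ≤ _ := by gcongr
  · -- the very bad boxes of all generations
    push Not at hcase
    have hex := hexpl k fun i hi => hcase i hi.le
    have hcap := capacity_vertexClosure_le (d := d) hd hfin (sc := sc k) (b := fun B => ω ∈ Eb B)
      (vb := fun B => ω ∈ Evb B) (k := k) hscsucc
      (fun i _ z hz => (hadm (sc k i)).initiation ω hfin (hscale i) z hz)
      (fun i _ z hz z' hz' hadj hb => (hadm (sc k i)).propagation ω z hz z' hz' hadj hb)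
      D V (fun i => Set.Finite.coe_toFinset _) (fun i => Set.Finite.coe_toFinset _)
    -- From `N - 1 ≤ 2 * d * cV + N / 4` and `N ≥ 4` follows `N / 2 ≤ 2 * d * cV`.
    have hVcap : (N : ℝ) / (4 * d) ≤ capacity (⋃ B ∈ gather (sc k) V k, B.verts) := by
      set cV := capacity (⋃ B ∈ gather (sc k) V k, B.verts) with hcV
      have h1 : ((D k).card : ℝ) ≤ t * N := by
        refine (hcase k le_rfl).trans (mul_le_of_le_one_right (by positivity) ?_)
        exact Real.rpow_le_one_of_one_le_of_nonpos (hl1.trans (hscale' k)) (by linarith)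
      have h2 : (sc k k : ℕ) = l := by simp [hsc, coe_dyadicScale]
      rw [h2] at hcap
      have h3 : 2 * (d : ℝ) * (2 * d * (((l : ℕ) : ℝ) ^ d * (D k).card)) ≤ N / 4 := by
        calc 2 * (d : ℝ) * (2 * d * (((l : ℕ) : ℝ) ^ d * (D k).card))
            ≤ 2 * (d : ℝ) * (2 * d * (((l : ℕ) : ℝ) ^ d * (t * N))) := by gcongr
          _ = (16 * (d : ℝ) ^ 2 * ((l : ℕ) : ℝ) ^ d * t) * (N / 4) := by ring
          _ = N / 4 := by rw [htl, one_mul]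
      rw [div_le_iff₀ (by positivity)]
      rw [mul_add] at hcap
      linarith
    have hne : (gather (sc k) V k).Nonempty := by
      rw [Finset.nonempty_iff_ne_empty]
      intro hempty
      rw [hempty] at hVcap
      simp only [Finset.notMem_empty, Set.iUnion_false, Set.iUnion_empty, capacity_empty] at hVcap
      have : (0 : ℝ) < N / (4 * d) := by positivity
      linarith
    set I : Interface d := ⟨gather (sc k) V k, hne, by
      intro B hB B' hB' hne
      obtain ⟨i, hi, z, hz, rfl⟩ := mem_gather.1 hB
      obtain ⟨j, hj, w, hw, rfl⟩ := mem_gather.1 hB'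
      exact disjoint_verts_of_mem_veryBadSet hscsucc hdisj hi hj ((hVmem i z).1 hz)
        ((hVmem j w).1 hw) hne⟩ with hI
    have hvbad : ∀ B ∈ I.boxes, ω ∈ Evb B ∧ ∃ i, B.scale = sc k i := by
      intro B hB
      obtain ⟨i, hi, z, hz, rfl⟩ := mem_gather.1 hB
      exact ⟨of_mem_veryBadSet ((hVmem i z).1 hz), i, rfl⟩
    refine ⟨I, (h𝓘 I).2 ⟨(h𝓕 k hkM k le_rfl D V hex).2, ?_, ?_⟩,
      fun B hB => Or.inr (hvbad B hB).1, ?_, ?_, Or.inl ?_⟩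
    · obtain ⟨B, hB, h1⟩ := Finset.exists_mem_eq_inf' I.nonempty Box.scale
      obtain ⟨-, i, hi⟩ := hvbad B hB
      rw [show I.minScale = sc k i from h1.trans hi]
      exact hscale' i
    · have := (hex.card_gather_le (sc k)).trans (hA k k le_rfl)
      change ((gather (sc k) V k).card : ℝ) ≤ _
      linarith
    · obtain ⟨B, hB, h1⟩ := Finset.exists_mem_eq_sup' I.nonempty Box.scale
      obtain ⟨-, i, hi⟩ := hvbad B hB
      rw [show I.maxScale = sc k i from h1.trans hi]
      exact hscale i
    · intro B hB
      obtain ⟨hBI, hBE⟩ := (hmemF I Eb B).1 hB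
      exact absurd (hvbad B hBI).1 (hdisj B hBE)
    · have : I.boxesWith Evb ω = gather (sc k) V k := by
        ext B
        rw [hmemF]
        exact ⟨fun h => h.1, fun h => ⟨h, (hvbad B h).1⟩⟩
      rw [this]
      exact hVcap
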